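/- **Curves.** Let $d\ge 0$. A polygonal curve $P:[0,1]\to\mathbb R^d$ is given by vertices $p_0,\dots,p_n$ ($n\ge1$) and parameters $0=\tau_0<\dots<\tau_n=1$, with $P$ running linearly along the edge from $p_{i}$ to $p_{i+1}$ on $[\tau_i,\tau_{i+1}]$; its complexity is $|P|=n+1$. $\mathbb X_\ell$ is the set of polygonal curves of complexity at most $\ell$. For $0\le s\le t\le1$, $P[s,t]$ is the subcurve from $s$ to $t$ (complexity: $2$ plus the number of vertices with parameter in $(s,t)$). $d_F(P,Q)=\inf_{f,g}\max_{t}\|P(f(t))-Q(g(t))\|$ over non-decreasing surjections $f,g$ of $[0,1]$, and $$\mathrm{Cov}_P(Q,\delta)=\bigcup\{[s,t] : 0\le s\le t\le 1,\ d_F(P[s,t],Q)\le\delta\}.$$ **Simplification.** Fix $\Delta>0$ and an integer $\ell\ge2$. A polygonal curve $S$ is a simplification of $P$ if $d_F(S,P)\le2\Delta$ and for every $Q\in\mathbb X_\ell$ and every $P[s,t]$ with $d_F(Q,P[s,t])\le\Delta$ there is a subcurve $S[s',t']$ with $d_F(P[s,t],S[s',t'])\le2\Delta$ and $|S[s',t']|\le\ell+2$.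 **Free space.** $\mathcal D_\delta(S,P)=\{(x,y)\in[0,1]^2:\|P(x)-S(y)\|\le\delta\}$. Its (closed) cells are the products of the parameter interval of an edge of $P$ and that of an edge of $S$. For $\alpha\ge1$, a closed set $A$ is an $(\alpha,\delta)$-free space of $S$ and $P$ if $\mathcal D_\delta\subset A\subset\mathcal D_{\alpha\delta}$, $A$ is convex in the interior of every cell, and a point on the boundary of a cell is in $A$ iff for every cell $C$ containing it, it is in the closure of $A\cap\operatorname{int}C$. Let $A_S$ be either such an $(\alpha,4\Delta)$-free space or the exact free space $\mathcal D_{4\Delta}(S,P)$. The leftmost (bottommost, rightmost, topmost) points of $A_S$ in a cell are the endpoints of the segment of points of $A_S$ in that cell that minimize $x$ (minimize $y$, maximize $x$, maximize $y$); together these are the extremal points. **Candidates.** For every edge $e$ of $S$ let $A_e$ be the restriction of $A_S$ to $e$, and let $\mathcal E(A_e)=\{\varepsilon_1<\varepsilon_2<\dots\}$ be any finite set of parameters on $e$ containing the $y$-coordinates of all extremal points of $A_e$. Write $e[s,t]$ for a subedge, $0$ and $1$ for the ends of $e$, and $\overleftarrow{e[s,t]}$ for its reversal. Let $\mathcal C_S(P)$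 consist of (I) the subcurves of $S$ from its $i$-th to its $(i+2^m)$-th vertex, $0\le m\le\lfloor\log_2\ell\rfloor$; (II) the subedges $e[0,\varepsilon_i]$, $e[\varepsilon_i,1]$ and their reversals; (III) the subedges $e[\varepsilon_i,\varepsilon_{i+2^m}]$, $0\le m\le\lfloor\log_2|\mathcal E(A_e)|\rfloor$, and their reversals. **Proxy coverage.** For a subcurve $s$ of type (I), $\widehat{\mathrm{Cov}}_{A_S}(s)=\mathrm{Cov}_P(s,4\Delta)$. For a subedge $e[s,t]$, $s\le t$, let $l_i(y)$ and $r_i(y)$ be the $x$-coordinates of the leftmost and the rightmost point of $A_e$ at height $y$ in the cell of the $i$-th edge of $P$, and $\infty$ if there is no point. Let $\mathcal R$ be the set of all inclusionwise maximal index pairs $(i,j)$ such that some path in $A_e$, monotone in both coordinates, leads from a point at height $s$ over edge $i$ of $P$ to a point at height $t$ over edge $j$ of $P$ (maximal: $(i,j)$ includes $(i',j')$ if $i\le i'$ and $j'\le j$). Let $\mathcal G=\{(i,j)\in\mathcal R:i<j\}$ and $\mathcal L=\{(i,i)\in\mathcal R\}$. Index $i$ is bad for $e[s,t]$ if $l_i(s),r_i(t)\ne\infty$,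 $x_{\rm top}\le l_i(s),r_i(t)\le x_{\rm bot}$ and $x_{\rm top}<x_{\rm bot}$ for the $x$-coordinates $x_{\rm top}$, $x_{\rm bot}$ of all topmost and all bottommost points of $A_e$ in cell $i$; otherwise it is good. Let $\widetilde{\mathcal G}$ result from $\mathcal G$ by repeatedly merging pairs $(a,b)$, $(c,d)$ to $(a,d)$ whenever $a<c<b<d$, or $b=c$ is good. Put $\hat l_i=l_i(s)$ and $\hat r_i=r_i(t)$ if $i$ is good, and $\hat l_i=r_i(s)$ and $\hat r_i=l_i(t)$ if $i$ is bad. Then $$\widehat{\mathrm{Cov}}_{A_S}(e[s,t])=\bigcup_{(i,i)\in\mathcal L,\ i\text{ good}}[l_i(s),r_i(t)]\ \cup\bigcup_{(i,j)\in\widetilde{\mathcal G}}[\hat l_i,\hat r_j].$$ For $\overleftarrow{e[s,t]}$ use the same definition for the reversed edge, whose free space is the mirror image $y\mapsto 1-y$ of $A_e$ ($y$ being the parameter on $e$, normalized to $[0,1]$), and its subedge from $1-t$ to $1-s$. **Theorem.** Let $P$ be a polygonal curve, $S$ a simplification of $P$, and let $A_S$, the sets $\mathcal E(A_e)$ and $\mathcal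 C_S(P)$ be as above. Then for every curve $\pi\in\mathbb X_\ell$ there is a set $S_\pi\subset\mathcal C_S(P)$ of size at most $16$ such that $$\mathrm{Cov}_P(\pi,\Delta)\subset\bigcup_{s\in S_\pi}\widehat{\mathrm{Cov}}_{A_S}(s).$$ -/

import Mathlib

open Set

/-- A polygonal curve in `ℝ^d`, parametrized over `[0, 1]`, with `edges + 1` vertices.  The `i`-th
edge is traversed linearly on the parameter interval `[knot i, knot (i + 1)]`.  (There is at least
one edge, because `knot 0 = 0` and `knot (last) = 1`.  Only `toFun` on `[0, 1]` matters.) -/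
structure PolyCurve (d : ℕ) where
  edges : ℕ
  vertex : Fin (edges + 1) → EuclideanSpace ℝ (Fin d)
  knot : Fin (edges + 1) → ℝ
  knot_strictMono : StrictMono knot
  knot_zero : knot 0 = 0
  knot_last : knot (Fin.last edges) = 1
  toFun : ℝ → EuclideanSpace ℝ (Fin d)
  toFun_edge : ∀ (i : Fin edges) (u : ℝ), u ∈ Icc (0 : ℝ) 1 →
    toFun (AffineMap.lineMap (knot i.castSucc) (knot i.succ) u) =
      AffineMap.lineMap (vertex i.castSucc) (vertex i.succ) u

/-- The complexity: the number of vertices. -/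
def PolyCurve.complexity {d : ℕ} (P : PolyCurve d) : ℕ := P.edges + 1

/-- The subcurve from parameter `s` to parameter `t`, reparametrized over `[0, 1]`. -/
def subcurve {d : ℕ} (γ : ℝ → EuclideanSpace ℝ (Fin d)) (s t : ℝ) :
    ℝ → EuclideanSpace ℝ (Fin d) :=
  fun u => γ (AffineMap.lineMap s t u)

/-- The complexity of the subcurve `P[s, t]`: its two endpoints, and the vertices of `P` strictly
between them. -/
noncomputable def PolyCurve.subComplexity {d : ℕ} (P : PolyCurve d) (s t : ℝ) : ℕ :=
  2 + {i : Fin (P.edges + 1) | s < P.knot i ∧ P.knot i < t}.ncard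

/-- The continuous Fréchet distance of two curves parametrized over `[0, 1]`. -/
noncomputable def frechetDist {d : ℕ} (γ η : ℝ → EuclideanSpace ℝ (Fin d)) : ℝ :=
  sInf {r : ℝ | ∃ f g : unitInterval → unitInterval,
    Monotone f ∧ Function.Surjective f ∧ Monotone g ∧ Function.Surjective g ∧
      ∀ t, dist (γ (f t)) (η (g t)) ≤ r}

/-- The `δ`-coverage of the curve `γ` on `P`. -/
def coverage {d : ℕ} (P : PolyCurve d) (γ : ℝ → EuclideanSpace ℝ (Fin d)) (δ : ℝ) : Set ℝ :=
  {x | ∃ s t : ℝ, 0 ≤ s ∧ s ≤ t ∧ t ≤ 1 ∧ frechetDist (subcurve P.toFun s t) γ ≤ δ ∧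
    x ∈ Icc s t}

/-- `S` is a simplification of `P` (with respect to `Δ` and `ℓ`). -/
def IsSimplification {d : ℕ} (Δ : ℝ) (ℓ : ℕ) (P S : PolyCurve d) : Prop :=
  frechetDist S.toFun P.toFun ≤ 2 * Δ ∧
  ∀ Q : PolyCurve d, Q.complexity ≤ ℓ →
    ∀ s t : ℝ, 0 ≤ s → s ≤ t → t ≤ 1 → frechetDist Q.toFun (subcurve P.toFun s t) ≤ Δ →
      ∃ s' t' : ℝ, 0 ≤ s' ∧ s' ≤ t' ∧ t' ≤ 1 ∧
        frechetDist (subcurve P.toFun s t) (subcurve S.toFun s' t') ≤ 2 * Δ ∧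
        S.subComplexity s' t' ≤ ℓ + 2

/-! ### Free spaces; the first coordinate belongs to `P`, the second to `S` -/

/-- The `δ`-free space of `S` and `P`. -/
def freeSpace {d : ℕ} (P S : PolyCurve d) (δ : ℝ) : Set (ℝ × ℝ) :=
  {q | q.1 ∈ Icc (0 : ℝ) 1 ∧ q.2 ∈ Icc (0 : ℝ) 1 ∧ dist (P.toFun q.1) (S.toFun q.2) ≤ δ}

/-- The (closed) cell of the free space diagram given by edge `i` of `P` and edge `k` of `S`. -/
def gridCell {d : ℕ} (P S : PolyCurve d) (i : Fin P.edges) (k : Fin S.edges) : Set (ℝ × ℝ) :=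
  Icc (P.knot i.castSucc) (P.knot i.succ) ×ˢ Icc (S.knot k.castSucc) (S.knot k.succ)

/-- `A` is an `α`-approximate `δ`-free space of `S` and `P`.  Closedness expresses that in every
cell the leftmost, rightmost, topmost and bottommost points of a non-empty `A` exist. -/
structure IsApproxFreeSpace {d : ℕ} (P S : PolyCurve d) (α δ : ℝ) (A : Set (ℝ × ℝ)) : Prop where
  lower : freeSpace P S δ ⊆ A
  upper : A ⊆ freeSpace P S (α * δ)
  convex : ∀ i k, Convex ℝ (A ∩ interior (gridCell P S i k))
  boundary : ∀ p : ℝ × ℝ, (∃ i k, p ∈ frontier (gridCell P S i k)) →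
    (p ∈ A ↔ ∀ i k, p ∈ gridCell P S i k → p ∈ closure (A ∩ interior (gridCell P S i k)))
  closed : IsClosed A

/-- The endpoints of the vertical segment of points of `K` with minimal first coordinate. -/
def leftmostPoints (K : Set (ℝ × ℝ)) : Set (ℝ × ℝ) :=
  {q | q ∈ K ∧ (∀ p ∈ K, q.1 ≤ p.1) ∧
    ((∀ p ∈ K, p.1 = q.1 → q.2 ≤ p.2) ∨ (∀ p ∈ K, p.1 = q.1 → p.2 ≤ q.2))}

/-- The endpoints of the vertical segment of points of `K` with maximal first coordinate. -/
def rightmostPoints (K : Set (ℝ × ℝ)) : Set (ℝ × ℝ) :=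
  {q | q ∈ K ∧ (∀ p ∈ K, p.1 ≤ q.1) ∧
    ((∀ p ∈ K, p.1 = q.1 → q.2 ≤ p.2) ∨ (∀ p ∈ K, p.1 = q.1 → p.2 ≤ q.2))}

/-- The endpoints of the horizontal segment of points of `K` with minimal second coordinate. -/
def bottommostPoints (K : Set (ℝ × ℝ)) : Set (ℝ × ℝ) :=
  {q | q ∈ K ∧ (∀ p ∈ K, q.2 ≤ p.2) ∧
    ((∀ p ∈ K, p.2 = q.2 → q.1 ≤ p.1) ∨ (∀ p ∈ K, p.2 = q.2 → p.1 ≤ q.1))}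

/-- The endpoints of the horizontal segment of points of `K` with maximal second coordinate. -/
def topmostPoints (K : Set (ℝ × ℝ)) : Set (ℝ × ℝ) :=
  {q | q ∈ K ∧ (∀ p ∈ K, p.2 ≤ q.2) ∧
    ((∀ p ∈ K, p.2 = q.2 → q.1 ≤ p.1) ∨ (∀ p ∈ K, p.2 = q.2 → p.1 ≤ q.1))}

/-- The extremal points of `K`, the part of an approximate free space in one cell. -/
def extremalPoints (K : Set (ℝ × ℝ)) : Set (ℝ × ℝ) :=
  leftmostPoints K ∪ rightmostPoints K ∪ bottommostPoints K ∪ topmostPoints K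

/-- `E` is a finite set of heights on edge `k` of `S` that contains the second coordinates of all
extremal points of `A` on that edge.  Heights are given in the parameter of `S`. -/
def IsHeightSet {d : ℕ} (P S : PolyCurve d) (A : Set (ℝ × ℝ)) (k : Fin S.edges)
    (E : Finset ℝ) : Prop :=
  (∀ y ∈ E, y ∈ Icc (S.knot k.castSucc) (S.knot k.succ)) ∧
  ∀ i : Fin P.edges, ∀ q ∈ extremalPoints (A ∩ gridCell P S i k), q.2 ∈ E

/-! ### Proxy coverage of a subedge

Here `B` is a subset of the parameter space of `P` and a single edge `e`, that is, the restriction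
`A_e` of an approximate free space to that edge, and `0 ≤ s ≤ t` are heights on `e`. -/

/-- The part of `B` in the `i`-th cell. -/
def column {d : ℕ} (P : PolyCurve d) (B : Set (ℝ × ℝ)) (i : Fin P.edges) : Set (ℝ × ℝ) :=
  {q | q ∈ B ∧ q.1 ∈ Icc (P.knot i.castSucc) (P.knot i.succ)}

/-- The points of `K` at height `y`. -/
def row (K : Set (ℝ × ℝ)) (y : ℝ) : Set ℝ := {x | (x, y) ∈ K}

/-- `l_i(y)`: first coordinate of the leftmost point at height `y`, for a non-empty row.  (An empty
row, for which one would write `∞`, is treated through non-emptiness of the row below.) -/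
noncomputable def leftAt (K : Set (ℝ × ℝ)) (y : ℝ) : ℝ := sInf (row K y)

/-- `r_i(y)`: first coordinate of the rightmost point at height `y`, for a non-empty row. -/
noncomputable def rightAt (K : Set (ℝ × ℝ)) (y : ℝ) : ℝ := sSup (row K y)

/-- The cell with content `K` is bad for `e[s, t]`: all topmost points are to the left of `l(s)` and
`r(t)`, which are finite and to the left of all bottommost points.  Ties are allowed, except that
every topmost point is strictly to the left of every bottommost point. -/
def IsBad (K : Set (ℝ × ℝ)) (s t : ℝ) : Prop :=
  (row K s).Nonempty ∧ (row K t).Nonempty ∧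
  (∀ p ∈ topmostPoints K, p.1 ≤ leftAt K s ∧ p.1 ≤ rightAt K t) ∧
  (∀ q ∈ bottommostPoints K, leftAt K s ≤ q.1 ∧ rightAt K t ≤ q.1) ∧
  (∀ p ∈ topmostPoints K, ∀ q ∈ bottommostPoints K, p.1 < q.1)

/-- There is a path from `p` to `q` in `A` that is monotone in both coordinates. -/
def HasMonotonePath (A : Set (ℝ × ℝ)) (p q : ℝ × ℝ) : Prop :=
  ∃ γ : unitInterval → ℝ × ℝ, Continuous γ ∧ Monotone γ ∧ γ 0 = p ∧ γ 1 = q ∧ ∀ u, γ u ∈ A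

/-- The index pairs `(i, j)` such that a monotone path leads from edge `i` of `P` at height `s` to
edge `j` of `P` at height `t`. -/
def pathPairs {d : ℕ} (P : PolyCurve d) (B : Set (ℝ × ℝ)) (s t : ℝ) :
    Set (Fin P.edges × Fin P.edges) :=
  {p | ∃ a ∈ Icc (P.knot p.1.castSucc) (P.knot p.1.succ),
    ∃ b ∈ Icc (P.knot p.2.castSucc) (P.knot p.2.succ), HasMonotonePath B (a, s) (b, t)}

/-- The inclusionwise maximal pairs of a set of index pairs, where `(i, j)` includes `(i', j')` if
`i ≤ i'` and `j' ≤ j`. -/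
def maximalPairs {n : ℕ} (M : Set (Fin n × Fin n)) : Set (Fin n × Fin n) :=
  {p | p ∈ M ∧ ∀ q ∈ M, q.1 ≤ p.1 → p.2 ≤ q.2 → q = p}

/-- The combinatorial representation of the coverage of `e[s, t]`. -/
def combRep {d : ℕ} (P : PolyCurve d) (B : Set (ℝ × ℝ)) (s t : ℝ) :
    Set (Fin P.edges × Fin P.edges) :=
  maximalPairs (pathPairs P B s t)

/-- The global group. -/
def globalGroup {d : ℕ} (P : PolyCurve d) (B : Set (ℝ × ℝ)) (s t : ℝ) :
    Set (Fin P.edges × Fin P.edges) :=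
  {p | p ∈ combRep P B s t ∧ p.1 < p.2}

/-- The pairs that arise from those of the global group by repeatedly merging pairs `(a, b)` and
`(c, d)` with `a < c < b < d`, or with `b = c` good for `e[s, t]`, to `(a, d)`. -/
inductive IsMerged {d : ℕ} (P : PolyCurve d) (B : Set (ℝ × ℝ)) (s t : ℝ) :
    Fin P.edges × Fin P.edges → Prop
  | base (p : Fin P.edges × Fin P.edges) : p ∈ globalGroup P B s t → IsMerged P B s t p
  | merge (p q : Fin P.edges × Fin P.edges) : IsMerged P B s t p → IsMerged P B s t q →
      ((p.1 < q.1 ∧ q.1 < p.2 ∧ p.2 < q.2) ∨ (p.2 = q.1 ∧ ¬ IsBad (column P B p.2) s t)) →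
      IsMerged P B s t (p.1, q.2)

/-- The reduced global group: what is left when all mergings have been carried out. -/
def reducedGlobalGroup {d : ℕ} (P : PolyCurve d) (B : Set (ℝ × ℝ)) (s t : ℝ) :
    Set (Fin P.edges × Fin P.edges) :=
  maximalPairs {p | IsMerged P B s t p}

open Classical in
/-- The left end `l̂_i(s)`. -/
noncomputable def leftHat (K : Set (ℝ × ℝ)) (s t : ℝ) : ℝ :=
  if IsBad K s t then rightAt K s else leftAt K s

open Classical in
/-- The right end `r̂_j(t)`. -/
noncomputable def rightHat (K : Set (ℝ × ℝ)) (s t : ℝ) : ℝ :=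
  if IsBad K s t then leftAt K t else rightAt K t

/-- The proxy coverage of the subedge `e[s, t]`. -/
def subedgeProxy {d : ℕ} (P : PolyCurve d) (B : Set (ℝ × ℝ)) (s t : ℝ) : Set ℝ :=
  {x | ∃ i : Fin P.edges, (i, i) ∈ combRep P B s t ∧ ¬ IsBad (column P B i) s t ∧
    x ∈ Icc (leftAt (column P B i) s) (rightAt (column P B i) t)} ∪
  {x | ∃ p ∈ reducedGlobalGroup P B s t,
    x ∈ Icc (leftHat (column P B p.1) s t) (rightHat (column P B p.2) s t)}

/-- The restriction `A_e` of `A` to the edge `e` with index `k`. -/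
def edgePart {d : ℕ} (S : PolyCurve d) (A : Set (ℝ × ℝ)) (k : Fin S.edges) : Set (ℝ × ℝ) :=
  {q | q ∈ A ∧ q.2 ∈ Icc (S.knot k.castSucc) (S.knot k.succ)}

/-- The reflection `y ↦ c - y` of the second coordinate. -/
def mirror (c : ℝ) (B : Set (ℝ × ℝ)) : Set (ℝ × ℝ) := {q | (q.1, c - q.2) ∈ B}

/-! ### Candidates -/

/-- Names for the subcurves of `S` that can be candidates: `vertexVertex i j` is the subcurve from
vertex `i` to vertex `j`; `subedge k s t false` is the subcurve `S[s, t]` of the edge `e` with index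
`k`, for parameters `s ≤ t` on that edge, and `subedge k s t true` is its reversal. -/
inductive Candidate {d : ℕ} (S : PolyCurve d) where
  | vertexVertex (i j : Fin (S.edges + 1)) : Candidate S
  | subedge (k : Fin S.edges) (s t : ℝ) (reversed : Bool) : Candidate S

/-- Type (I), (II) and (III) subcurves of `S`, where `E k` is the height set of the edge `k`. -/
inductive IsCandidate {d : ℕ} (S : PolyCurve d) (ℓ : ℕ) (E : Fin S.edges → Finset ℝ) :
    Candidate S → Prop
  | typeI (i j : Fin (S.edges + 1)) (m : ℕ) : m ≤ Nat.log 2 ℓ → (j : ℕ) = i + 2 ^ m →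
      IsCandidate S ℓ E (.vertexVertex i j)
  | typeII_start (k : Fin S.edges) (y : ℝ) (rev : Bool) : y ∈ E k →
      IsCandidate S ℓ E (.subedge k (S.knot k.castSucc) y rev)
  | typeII_end (k : Fin S.edges) (y : ℝ) (rev : Bool) : y ∈ E k →
      IsCandidate S ℓ E (.subedge k y (S.knot k.succ) rev)
  | typeIII (k : Fin S.edges) (i j : Fin (E k).card) (m : ℕ) (rev : Bool) :
      m ≤ Nat.log 2 (E k).card → (j : ℕ) = i + 2 ^ m →
      IsCandidate S ℓ E
        (.subedge k ((E k).orderEmbOfFin rfl i) ((E k).orderEmbOfFin rfl j) rev)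

/-- The proxy coverage of a candidate, for an approximate `δ`-free space `A` of `S` and `P`.  The
reversal of `e[s, t]` is the subedge from `c - t` to `c - s` of the reversed edge, whose free space
is the mirror image of that of `e`; here `c` is the sum of the two end parameters of `e`. -/
def proxyCoverage {d : ℕ} (P S : PolyCurve d) (A : Set (ℝ × ℝ)) (δ : ℝ) : Candidate S → Set ℝ
  | .vertexVertex i j => coverage P (subcurve S.toFun (S.knot i) (S.knot j)) δ
  | .subedge k s t false => subedgeProxy P (edgePart S A k) s t
  | .subedge k s t true =>
      subedgeProxy P (mirror (S.knot k.castSucc + S.knot k.succ) (edgePart S A k))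
        (S.knot k.castSucc + S.knot k.succ - t) (S.knot k.castSucc + S.knot k.succ - s)

/-!
Fix one subcurve `P[s₀, t₀]` within distance `Δ` of `Q` and let `S[y, z]` be the subcurve of the
simplification `S` assigned to it. By the triangle inequality every subcurve `P[s, t]` within
distance `Δ` of `Q` is within `4 * Δ` of `S[y, z]`. As the Fréchet distance is attained
(`exists_matching_of_frechetDist_le`), `[s, t]` is swept by a monotone path in the exact free space,
which is contained in `A`, from height `y` to height `z`. It remains to cover all such sweeps.

*Subedges between arbitrary heights.* Every monotone path in `A` from height `u` to height `v` of an
edge is covered by the proxy coverages of `e[u, v]` and of its reversal taken together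
(`HasMonotonePath.Icc_subset_twoWayProxy`): the index pair of the path is dominated by a pair of the
reduced global group, and what a bad cell loses in one direction is returned by the other direction,
for which the cell is good. Here only convexity and compactness of `A` in the closed cells are used.

*Rounding.* Let `u < v` be consecutive in the height set. Between `u` and `v` the ends of the rows
of a cell are monotone functions of the height, and every cell that reaches into the gap has points
at heights `u` and `v`. Hence `e[u, v]` and its reversal cover every path between the heights `u`
and `v`, unless it stays at height `u` or at height `v`
(`HasMonotonePath.Icc_subset_twoWayProxy_of_gap`). For a range of heights `y < z` on one edge, the
two ends are rounded to the height set at the cost of two candidates each, and the range between the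
rounded heights is the union of two ranges with a power of two of steps, which cost two candidates
each. This makes at most eight candidates, and at most six if one of `y`, `z` is in the height set.

*Counting.* If `S[y, z]` has interior vertices, it is cut at the first and at the last of them. The
parts on the two end edges take six candidates each, and the part between vertices two of type (I).
If it has none and `y < z`, eight suffice, and if `y = z` is not in the height set, two do.

*A single point `S(y)` with `y` in the height set.* This is the delicate case, as `e[y, y]` is not a
candidate. The four candidates spanning the gaps next to `y` cover each horizontal path that meets a
cell with points at other heights (`IsEdgeData.Icc_subset_gapProxy`). If the path for some `P[s, t]`
meets no such cell, all its points are at distance exactly `4 * Δ` from `S(y)`, so that `Q` is at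
distance exactly `3 * Δ` from `S(y)` throughout. A polygonal curve on a sphere is constant, and
equality in the triangle inequality then determines the point `P(x)` for every `x` that is not yet
covered. Two more candidates on an edge of `S` close to this point cover all of these `x`.
-/

open Filter Topology

/-! ### Polygonal curves -/

namespace PolyCurve

variable {d : ℕ} (P : PolyCurve d)

lemma knot_castSucc_lt_succ (i : Fin P.edges) : P.knot i.castSucc < P.knot i.succ :=
  P.knot_strictMono i.castSucc_lt_succ

lemma knot_mem (i : Fin (P.edges + 1)) : P.knot i ∈ Icc (0 : ℝ) 1 :=
  ⟨P.knot_zero ▸ P.knot_strictMono.monotone (Fin.zero_le i),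
    P.knot_last ▸ P.knot_strictMono.monotone (Fin.le_last i)⟩

lemma knot_succ_le_castSucc {i j : Fin P.edges} (h : i < j) :
    P.knot i.succ ≤ P.knot j.castSucc :=
  P.knot_strictMono.monotone (Fin.le_iff_val_le_val.2 (by simpa using Fin.lt_def.1 h))

lemma edges_pos : 0 < P.edges := by
  rcases Nat.eq_zero_or_pos P.edges with h | h
  · have h0 : (0 : Fin (P.edges + 1)) = Fin.last P.edges := by
      apply Fin.ext
      simp [h]
    have h1 := P.knot_zero
    rw [h0, P.knot_last] at h1
    exact absurd h1 one_ne_zero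
  · exact h

lemma exists_edge_of_lt {y : ℝ} (h0 : 0 ≤ y) (h1 : y < 1) :
    ∃ k : Fin P.edges, P.knot k.castSucc ≤ y ∧ y < P.knot k.succ := by
  by_contra! h
  have key : ∀ i : Fin (P.edges + 1), P.knot i ≤ y := fun i =>
    Fin.induction (P.knot_zero.trans_le h0) (fun i hi => h i hi) i
  have := key (Fin.last _)
  rw [P.knot_last] at this
  linarith

lemma exists_edge_of_pos {y : ℝ} (h0 : 0 < y) (h1 : y ≤ 1) :
    ∃ k : Fin P.edges, P.knot k.castSucc < y ∧ y ≤ P.knot k.succ := by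
  by_contra! h
  have key : ∀ i : Fin (P.edges + 1), P.knot i < y := fun i =>
    Fin.induction (P.knot_zero.trans_lt h0) (fun i hi => h i hi) i
  have := key (Fin.last _)
  rw [P.knot_last] at this
  linarith

lemma exists_edge {y : ℝ} (hy : y ∈ Icc (0 : ℝ) 1) :
    ∃ k : Fin P.edges, y ∈ Icc (P.knot k.castSucc) (P.knot k.succ) := by
  rcases hy.2.lt_or_eq with h | h
  · obtain ⟨k, hk⟩ := P.exists_edge_of_lt hy.1 h
    exact ⟨k, hk.1, hk.2.le⟩
  · obtain ⟨k, hk⟩ := P.exists_edge_of_pos (h ▸ one_pos) hy.2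
    exact ⟨k, hk.1.le, hk.2⟩

/-- On an edge the curve is an affine function of the parameter. -/
lemma toFun_eq_lineMap (i : Fin P.edges) {y : ℝ}
    (hy : y ∈ Icc (P.knot i.castSucc) (P.knot i.succ)) :
    P.toFun y = AffineMap.lineMap (P.vertex i.castSucc) (P.vertex i.succ)
      ((y - P.knot i.castSucc) / (P.knot i.succ - P.knot i.castSucc)) := by
  have hlt := P.knot_castSucc_lt_succ i
  have hpos : 0 < P.knot i.succ - P.knot i.castSucc := sub_pos.2 hlt
  rw [← P.toFun_edge i _ ⟨div_nonneg (by linarith [hy.1]) hpos.le,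
    (div_le_one hpos).2 (by linarith [hy.2])⟩]
  congr 1
  rw [AffineMap.lineMap_apply_ring']
  field_simp
  ring

lemma continuousOn_edge (i : Fin P.edges) :
    ContinuousOn P.toFun (Icc (P.knot i.castSucc) (P.knot i.succ)) := by
  refine ContinuousOn.congr (f := fun y => AffineMap.lineMap (P.vertex i.castSucc)
    (P.vertex i.succ) ((y - P.knot i.castSucc) / (P.knot i.succ - P.knot i.castSucc))) ?_
    (fun y hy => P.toFun_eq_lineMap i hy)
  simp only [AffineMap.lineMap_apply]
  fun_prop

lemma continuousOn : ContinuousOn P.toFun (Icc 0 1) := by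
  refine (LocallyFinite.continuousOn_iUnion (locallyFinite_of_finite _) (fun _ => isClosed_Icc)
    P.continuousOn_edge).mono ?_
  intro y hy
  exact mem_iUnion.2 (P.exists_edge hy)

lemma toFun_knot (i : Fin (P.edges + 1)) : P.toFun (P.knot i) = P.vertex i := by
  rcases Fin.eq_castSucc_or_eq_last i with ⟨j, rfl⟩ | rfl
  · rw [P.toFun_eq_lineMap j ⟨le_rfl, (P.knot_castSucc_lt_succ j).le⟩]
    simp
  · obtain ⟨j, hj⟩ := Fin.exists_succ_eq.2
      (show Fin.last P.edges ≠ 0 from by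
        have := P.edges_pos
        intro h
        have := congrArg Fin.val h
        simp at this
        omega)
    rw [← hj, P.toFun_eq_lineMap j ⟨(P.knot_castSucc_lt_succ j).le, le_rfl⟩,
      div_self (sub_pos.2 (P.knot_castSucc_lt_succ j)).ne']
    simp

/-- A polygonal curve that runs on a sphere is constant, because spheres contain no segments. -/
lemma eq_of_dist_eq {p : EuclideanSpace ℝ (Fin d)} {r : ℝ}
    (h : ∀ u ∈ Icc (0 : ℝ) 1, dist (P.toFun u) p = r) {u : ℝ} (hu : u ∈ Icc (0 : ℝ) 1) :
    P.toFun u = P.toFun 0 := by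
  have step : ∀ i : Fin P.edges, P.vertex i.succ = P.vertex i.castSucc := by
    intro i
    by_contra hne
    have h1 := h _ (P.knot_mem i.castSucc)
    have h2 := h _ (P.knot_mem i.succ)
    rw [P.toFun_knot] at h1 h2
    have hl := P.knot_castSucc_lt_succ i
    have hm : (P.knot i.castSucc + P.knot i.succ) / 2 ∈
        Icc (P.knot i.castSucc) (P.knot i.succ) := by
      constructor <;> linarith
    have h3 := h _ ⟨(P.knot_mem i.castSucc).1.trans hm.1, hm.2.trans (P.knot_mem i.succ).2⟩
    rw [P.toFun_eq_lineMap i hm] at h3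
    have h4 : ((P.knot i.castSucc + P.knot i.succ) / 2 - P.knot i.castSucc) /
        (P.knot i.succ - P.knot i.castSucc) = 1 / 2 := by
      have := (sub_pos.2 hl).ne'
      field_simp
      ring
    rw [h4] at h3
    have h5 : Sbtw ℝ (P.vertex i.castSucc)
        (AffineMap.lineMap (P.vertex i.castSucc) (P.vertex i.succ) (1 / 2 : ℝ))
        (P.vertex i.succ) :=
      sbtw_lineMap_iff.2 ⟨fun h => hne h.symm, by norm_num⟩
    have h6 := h5.dist_lt_max_dist p
    rw [h1, h2, h3, max_self] at h6
    exact lt_irrefl _ h6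
  have hv : ∀ i : Fin (P.edges + 1), P.vertex i = P.vertex 0 := fun i =>
    Fin.induction (motive := fun i => P.vertex i = P.vertex 0) rfl
      (fun i hi => (step i).trans hi) i
  obtain ⟨k, hk⟩ := P.exists_edge hu
  rw [P.toFun_eq_lineMap k hk, hv k.succ, hv k.castSucc, AffineMap.lineMap_same_apply,
    ← hv 0, ← P.toFun_knot, P.knot_zero]

end PolyCurve

/-! ### The Fréchet distance -/

section Frechet

variable {d : ℕ} {γ η ζ : ℝ → EuclideanSpace ℝ (Fin d)} {r δ : ℝ}

lemma continuous_comp_coe (hγ : ContinuousOn γ (Icc 0 1)) :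
    Continuous fun t : unitInterval => γ t :=
  hγ.comp_continuous continuous_subtype_val fun t => t.2

lemma frechetDist_comm : frechetDist γ η = frechetDist η γ := by
  unfold frechetDist
  congr 1
  ext r
  constructor <;>
  · rintro ⟨f, g, hf, hf', hg, hg', h⟩
    exact ⟨g, f, hg, hg', hf, hf', fun t => by rw [dist_comm]; exact h t⟩

lemma frechetDist_le (f g : unitInterval → unitInterval) (hf : Monotone f)
    (hf' : Function.Surjective f) (hg : Monotone g) (hg' : Function.Surjective g)
    (h : ∀ t, dist (γ (f t)) (η (g t)) ≤ r) : frechetDist γ η ≤ r :=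
  csInf_le ⟨0, fun _ ⟨_, _, _, _, _, _, h⟩ => dist_nonneg.trans (h 0)⟩ ⟨f, g, hf, hf', hg, hg', h⟩

/-- A slight change makes a reparametrization strictly monotone, hence bijective, at the cost of an
arbitrarily small change of the curve. -/
lemma exists_orderIso_dist_le (hγ : ContinuousOn γ (Icc 0 1)) {f : unitInterval → unitInterval}
    (hf : Monotone f) (hf' : Function.Surjective f) {ε : ℝ} (hε : 0 < ε) :
    ∃ φ : unitInterval ≃o unitInterval, ∀ t, dist (γ (φ t)) (γ (f t)) ≤ ε := by
  obtain ⟨θ, hθ, hθ'⟩ := Metric.uniformContinuous_iff.1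
    (CompactSpace.uniformContinuous_of_continuous (continuous_comp_coe hγ)) ε hε
  obtain ⟨c, hc0, hc1, hcθ⟩ : ∃ c : ℝ, 0 < c ∧ c ≤ 1 ∧ c < θ :=
    ⟨min 1 (θ / 2), by positivity, min_le_left _ _, (min_le_right _ _).trans_lt (by linarith)⟩
  have hmem : ∀ t : unitInterval, (1 - c) * (f t : ℝ) + c * t ∈ Icc (0 : ℝ) 1 := fun t =>
    ⟨by nlinarith [(f t).2.1, t.2.1], by nlinarith [(f t).2.2, t.2.2]⟩
  have hf0 : f 0 = 0 := by
    obtain ⟨t, ht⟩ := hf' 0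
    exact le_antisymm ((hf unitInterval.nonneg').trans_eq ht) (f 0).2.1
  have hf1 : f 1 = 1 := by
    obtain ⟨t, ht⟩ := hf' 1
    exact le_antisymm (f 1).2.2 (ht.symm.trans_le (hf unitInterval.le_one'))
  let F : unitInterval → unitInterval := fun t => ⟨_, hmem t⟩
  have hF : StrictMono F := fun t u htu => by
    have h1 : (f t : ℝ) ≤ f u := hf htu.le
    have h2 : (t : ℝ) < u := htu
    show (1 - c) * (f t : ℝ) + c * t < (1 - c) * (f u : ℝ) + c * u
    nlinarith
  have hFc : Continuous F := by
    have := hf.continuous_of_surjective hf'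
    exact Continuous.subtype_mk (by fun_prop) _
  have hF' : Function.Surjective F := fun y =>
    mem_range_of_exists_le_of_exists_ge hFc ⟨0, by
      show (1 - c) * (f 0 : ℝ) + c * (0 : unitInterval) ≤ y
      simp [hf0, y.2.1]⟩ ⟨1, by
      show (y : ℝ) ≤ (1 - c) * (f 1 : ℝ) + c * (1 : unitInterval)
      simp [hf1, y.2.2]⟩
  refine ⟨hF.orderIsoOfSurjective F hF', fun t => (hθ' ?_).le⟩
  show dist ((1 - c) * (f t : ℝ) + c * t) (f t) < θ
  rw [Real.dist_eq, abs_lt]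
  constructor <;> nlinarith [(f t).2.1, t.2.1, (f t).2.2, t.2.2]

/-- Above the Fréchet distance a single increasing bijection serves as the reparametrization. -/
lemma exists_orderIso_of_frechetDist_lt (hγ : ContinuousOn γ (Icc 0 1))
    (hη : ContinuousOn η (Icc 0 1)) (h : frechetDist γ η < r) :
    ∃ φ : unitInterval ≃o unitInterval, ∀ t, dist (γ (φ t)) (η t) ≤ r := by
  have hne : {r : ℝ | ∃ f g : unitInterval → unitInterval, Monotone f ∧ Function.Surjective f ∧
      Monotone g ∧ Function.Surjective g ∧ ∀ t, dist (γ (f t)) (η (g t)) ≤ r}.Nonempty := by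
    obtain ⟨C, hC⟩ := (isCompact_range
      ((continuous_comp_coe hγ).dist (continuous_comp_coe hη))).bddAbove
    exact ⟨C, id, id, monotone_id, Function.surjective_id, monotone_id, Function.surjective_id,
      fun t => hC ⟨t, rfl⟩⟩
  obtain ⟨r', ⟨f, g, hf, hf', hg, hg', hfg⟩, hr'⟩ := exists_lt_of_csInf_lt hne h
  obtain ⟨φ, hφ⟩ := exists_orderIso_dist_le hγ hf hf' (half_pos (sub_pos.2 hr'))
  obtain ⟨ψ, hψ⟩ := exists_orderIso_dist_le hη hg hg' (half_pos (sub_pos.2 hr'))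
  refine ⟨ψ.symm.trans φ, fun t => ?_⟩
  have h1 := hφ (ψ.symm t)
  have h2 := hψ (ψ.symm t)
  have h3 := hfg (ψ.symm t)
  rw [ψ.apply_symm_apply] at h2
  have := dist_triangle4 (γ (φ (ψ.symm t))) (γ (f (ψ.symm t))) (η (g (ψ.symm t))) (η t)
  rw [dist_comm (η (g _))] at this
  show dist (γ (φ (ψ.symm t))) (η t) ≤ r
  linarith

lemma frechetDist_triangle (hγ : ContinuousOn γ (Icc 0 1)) (hη : ContinuousOn η (Icc 0 1))
    (hζ : ContinuousOn ζ (Icc 0 1)) : frechetDist γ ζ ≤ frechetDist γ η + frechetDist η ζ := by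
  refine le_of_forall_pos_le_add fun ε hε => ?_
  obtain ⟨φ, hφ⟩ := exists_orderIso_of_frechetDist_lt hγ hη
    (lt_add_of_pos_right _ (half_pos hε))
  obtain ⟨ψ, hψ⟩ := exists_orderIso_of_frechetDist_lt hη hζ
    (lt_add_of_pos_right _ (half_pos hε))
  refine frechetDist_le (ψ.trans φ) id (ψ.trans φ).monotone (ψ.trans φ).surjective monotone_id
    Function.surjective_id fun t => ?_
  have := dist_triangle (γ (φ (ψ t))) (η (ψ t)) (ζ t)
  have h1 := hφ (ψ t)
  have h2 := hψ t
  show dist (γ (φ (ψ t))) (ζ t) ≤ _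
  linarith

/-- The Fréchet distance is attained.  Reparametrizations `f`, `g` normalized by `f t + g t = 2 t`
have a common Lipschitz constant, so that a pointwise limit along an ultrafilter of nearly optimal
ones is again continuous. -/
lemma exists_matching_of_frechetDist_le (hγ : ContinuousOn γ (Icc 0 1))
    (hη : ContinuousOn η (Icc 0 1)) (h : frechetDist γ η ≤ δ) :
    ∃ f g : unitInterval → unitInterval, Monotone f ∧ Monotone g ∧ Continuous f ∧ Continuous g ∧
      f 0 = 0 ∧ f 1 = 1 ∧ g 0 = 0 ∧ g 1 = 1 ∧ ∀ t, dist (γ (f t)) (η (g t)) ≤ δ := by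
  have happrox : ∀ n : ℕ, ∃ f g : unitInterval → unitInterval, Monotone f ∧ Monotone g ∧
      (∀ t, (f t : ℝ) + g t = 2 * t) ∧ ∀ t, dist (γ (f t)) (η (g t)) ≤ δ + 1 / (n + 1) := by
    intro n
    obtain ⟨φ, hφ⟩ := exists_orderIso_of_frechetDist_lt hγ hη
      (h.trans_lt (lt_add_of_pos_right δ (Nat.one_div_pos_of_nat (n := n))))
    let σ : unitInterval → unitInterval := fun t => ⟨((φ t : ℝ) + t) / 2,
      by linarith [(φ t).2.1, t.2.1], by linarith [(φ t).2.2, t.2.2]⟩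
    have hσ : StrictMono σ := fun t u htu => by
      have h1 : (φ t : ℝ) < φ u := φ.strictMono htu
      have h2 : (t : ℝ) < u := htu
      show ((φ t : ℝ) + t) / 2 < ((φ u : ℝ) + u) / 2
      linarith
    have hσc : Continuous σ := by
      have := φ.continuous
      exact Continuous.subtype_mk (by fun_prop) _
    have hφ0 : φ 0 = 0 := φ.map_bot
    have hφ1 : φ 1 = 1 := φ.map_top
    have hσ' : Function.Surjective σ := fun y =>
      mem_range_of_exists_le_of_exists_ge hσc ⟨0, by
        show ((φ 0 : ℝ) + (0 : unitInterval)) / 2 ≤ y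
        simp [hφ0, y.2.1]⟩ ⟨1, by
        show (y : ℝ) ≤ ((φ 1 : ℝ) + (1 : unitInterval)) / 2
        simp [hφ1, y.2.2]⟩
    let ψ := (hσ.orderIsoOfSurjective σ hσ').symm
    refine ⟨ψ.trans φ, ψ, (ψ.trans φ).monotone, ψ.monotone, fun t => ?_, fun t => hφ (ψ t)⟩
    have h1 : σ (ψ t) = t := (hσ.orderIsoOfSurjective σ hσ').apply_symm_apply t
    have h2 : ((φ (ψ t) : ℝ) + ψ t) / 2 = t := congrArg Subtype.val h1
    show (φ (ψ t) : ℝ) + ψ t = 2 * t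
    linarith
  choose f g hf hg hfg hd using happrox
  let U : Ultrafilter ℕ := Filter.hyperfilter ℕ
  have hU : (U : Filter ℕ) ≤ atTop := Nat.hyperfilter_le_atTop
  let F : unitInterval → unitInterval := fun t => (U.map fun n => f n t).lim
  let G : unitInterval → unitInterval := fun t => (U.map fun n => g n t).lim
  have hF : ∀ t, Tendsto (fun n => f n t) U (𝓝 (F t)) := fun t => Ultrafilter.le_nhds_lim _
  have hG : ∀ t, Tendsto (fun n => g n t) U (𝓝 (G t)) := fun t => Ultrafilter.le_nhds_lim _
  have hFm : Monotone F := fun t u htu => le_of_tendsto_of_tendsto' (hF t) (hF u) fun n => hf n htu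
  have hGm : Monotone G := fun t u htu => le_of_tendsto_of_tendsto' (hG t) (hG u) fun n => hg n htu
  have hFG : ∀ t, (F t : ℝ) + G t = 2 * t := fun t =>
    tendsto_nhds_unique (((continuous_subtype_val.tendsto _).comp (hF t)).add
      ((continuous_subtype_val.tendsto _).comp (hG t)))
      (tendsto_const_nhds.congr fun n => (hfg n t).symm)
  have hlip : ∀ F G : unitInterval → unitInterval, Monotone F → Monotone G →
      (∀ t, (F t : ℝ) + G t = 2 * t) → Continuous F := by
    intro F G hFm hGm hFG
    have key : ∀ t u, t ≤ u → dist (F t) (F u) ≤ 2 * dist t u := by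
      intro t u htu
      have h1 : (F t : ℝ) ≤ F u := hFm htu
      have h2 : (G t : ℝ) ≤ G u := hGm htu
      have h3 : (t : ℝ) ≤ u := htu
      rw [Subtype.dist_eq, Subtype.dist_eq, Real.dist_eq, Real.dist_eq, abs_sub_comm,
        abs_of_nonneg (by linarith), abs_sub_comm, abs_of_nonneg (by linarith)]
      linarith [hFG t, hFG u]
    refine (LipschitzWith.of_dist_le_mul (K := 2) fun t u => ?_).continuous
    rcases le_total t u with h | h
    · exact key t u h
    · rw [dist_comm, dist_comm t]
      exact key u t h
  refine ⟨F, G, hFm, hGm, hlip F G hFm hGm hFG,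
    hlip G F hGm hFm fun t => (add_comm _ _).trans (hFG t), ?_, ?_, ?_, ?_, fun t => ?_⟩
  · have := hFG 0
    simp only [Icc.coe_zero, mul_zero] at this
    exact Subtype.ext (show (F 0 : ℝ) = 0 by linarith [(F 0).2.1, (G 0).2.1])
  · have := hFG 1
    simp only [Icc.coe_one, mul_one] at this
    exact Subtype.ext (show (F 1 : ℝ) = 1 by linarith [(F 1).2.2, (G 1).2.2])
  · have := hFG 0
    simp only [Icc.coe_zero, mul_zero] at this
    exact Subtype.ext (show (G 0 : ℝ) = 0 by linarith [(F 0).2.1, (G 0).2.1])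
  · have := hFG 1
    simp only [Icc.coe_one, mul_one] at this
    exact Subtype.ext (show (G 1 : ℝ) = 1 by linarith [(F 1).2.2, (G 1).2.2])
  · have h1 : Tendsto (fun n => dist (γ (f n t)) (η (g n t))) U
        (𝓝 (dist (γ (F t)) (η (G t)))) :=
      (((continuous_comp_coe hγ).tendsto _).comp (hF t)).dist
        (((continuous_comp_coe hη).tendsto _).comp (hG t))
    have h2 : Tendsto (fun n : ℕ => δ + 1 / ((n : ℝ) + 1)) U (𝓝 (δ + 0)) :=
      (tendsto_const_nhds.add tendsto_one_div_add_atTop_nhds_zero_nat).mono_left hU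
    rw [add_zero] at h2
    exact le_of_tendsto_of_tendsto' h1 h2 fun n => hd n t

lemma lineMap_mem_Icc {s t u : ℝ} (hst : s ≤ t) (hu : u ∈ Icc (0 : ℝ) 1) :
    AffineMap.lineMap s t u ∈ Icc s t := by
  rw [AffineMap.lineMap_apply_ring']
  constructor <;> nlinarith [hu.1, hu.2]

lemma continuousOn_subcurve (hγ : ContinuousOn γ (Icc 0 1)) {s t : ℝ} (hs : 0 ≤ s) (hst : s ≤ t)
    (ht : t ≤ 1) : ContinuousOn (subcurve γ s t) (Icc 0 1) := by
  refine hγ.comp (f := fun u => AffineMap.lineMap s t u) (by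
    simp only [AffineMap.lineMap_apply_ring']; fun_prop) fun u hu => ?_
  have := lineMap_mem_Icc hst hu
  exact ⟨hs.trans this.1, this.2.trans ht⟩

end Frechet

/-! ### Monotone paths -/

namespace HasMonotonePath

variable {A A' : Set (ℝ × ℝ)} {p q r : ℝ × ℝ}

/-- The part of a monotone path between two times, reparametrized. -/
lemma of_le {γ : unitInterval → ℝ × ℝ} (hc : Continuous γ) (hm : Monotone γ)
    (hA : ∀ u, γ u ∈ A) {τ τ' : unitInterval} (h : τ ≤ τ') : HasMonotonePath A (γ τ) (γ τ') := by
  have h' : (τ : ℝ) ≤ τ' := h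
  let σ : unitInterval → unitInterval := fun u => ⟨AffineMap.lineMap (τ : ℝ) (τ' : ℝ) (u : ℝ),
    τ.2.1.trans (lineMap_mem_Icc h' u.2).1, (lineMap_mem_Icc h' u.2).2.trans τ'.2.2⟩
  have hσc : Continuous σ := Continuous.subtype_mk (by
    simp only [AffineMap.lineMap_apply_ring']; fun_prop) _
  have hσm : Monotone σ := fun u v huv => by
    have : (u : ℝ) ≤ v := huv
    show AffineMap.lineMap (τ : ℝ) (τ' : ℝ) (u : ℝ) ≤ AffineMap.lineMap (τ : ℝ) (τ' : ℝ) (v : ℝ)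
    rw [AffineMap.lineMap_apply_ring', AffineMap.lineMap_apply_ring']
    nlinarith
  have h0 : σ 0 = τ := Subtype.ext (by simp [σ])
  have h1 : σ 1 = τ' := Subtype.ext (by simp [σ])
  exact ⟨γ ∘ σ, hc.comp hσc, hm.comp hσm, by simp [h0], by simp [h1], fun u => hA _⟩

lemma left_mem (h : HasMonotonePath A p q) : p ∈ A := by
  obtain ⟨γ, -, -, h0, -, hA⟩ := h
  exact h0 ▸ hA 0

lemma right_mem (h : HasMonotonePath A p q) : q ∈ A := by
  obtain ⟨γ, -, -, -, h1, hA⟩ := h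
  exact h1 ▸ hA 1

lemma le (h : HasMonotonePath A p q) : p ≤ q := by
  obtain ⟨γ, -, hm, h0, h1, -⟩ := h
  exact h0 ▸ h1 ▸ hm unitInterval.le_one'

lemma mono (h : HasMonotonePath A p q) (hA : A ∩ Icc p q ⊆ A') : HasMonotonePath A' p q := by
  obtain ⟨γ, hc, hm, h0, h1, hγ⟩ := h
  exact ⟨γ, hc, hm, h0, h1, fun u => hA ⟨hγ u, h0 ▸ hm unitInterval.nonneg',
    h1 ▸ hm unitInterval.le_one'⟩⟩

/-- A monotone path passes every height between those of its ends and can be cut there. -/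
lemma split_snd (h : HasMonotonePath A p q) {y : ℝ} (hy : y ∈ Icc p.2 q.2) :
    ∃ x ∈ Icc p.1 q.1, HasMonotonePath A p (x, y) ∧ HasMonotonePath A (x, y) q := by
  obtain ⟨γ, hc, hm, h0, h1, hγ⟩ := h
  obtain ⟨τ, hτ⟩ := mem_range_of_exists_le_of_exists_ge (f := fun u => (γ u).2) (c := y)
    (by fun_prop) ⟨0, by simpa [h0] using hy.1⟩ ⟨1, by simpa [h1] using hy.2⟩
  have e : ((γ τ).1, y) = γ τ := Prod.ext rfl hτ.symm
  have h2 := of_le hc hm hγ (unitInterval.nonneg' (t := τ))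
  have h3 := of_le hc hm hγ (unitInterval.le_one' (t := τ))
  rw [h0] at h2
  rw [h1] at h3
  exact ⟨(γ τ).1, ⟨h2.le.1, h3.le.1⟩, e ▸ h2, e ▸ h3⟩

lemma split_fst (h : HasMonotonePath A p q) {x : ℝ} (hx : x ∈ Icc p.1 q.1) :
    ∃ y ∈ Icc p.2 q.2, HasMonotonePath A p (x, y) ∧ HasMonotonePath A (x, y) q := by
  obtain ⟨γ, hc, hm, h0, h1, hγ⟩ := h
  obtain ⟨τ, hτ⟩ := mem_range_of_exists_le_of_exists_ge (f := fun u => (γ u).1) (c := x)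
    (by fun_prop) ⟨0, by simpa [h0] using hx.1⟩ ⟨1, by simpa [h1] using hx.2⟩
  have e : (x, (γ τ).2) = γ τ := Prod.ext hτ.symm rfl
  have h2 := of_le hc hm hγ (unitInterval.nonneg' (t := τ))
  have h3 := of_le hc hm hγ (unitInterval.le_one' (t := τ))
  rw [h0] at h2
  rw [h1] at h3
  exact ⟨(γ τ).2, ⟨h2.le.2, h3.le.2⟩, e ▸ h2, e ▸ h3⟩

lemma trans (h : HasMonotonePath A p q) (h' : HasMonotonePath A q r) : HasMonotonePath A p r := by
  obtain ⟨γ, hc, hm, h0, h1, hγ⟩ := h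
  obtain ⟨γ', hc', hm', h0', h1', hγ'⟩ := h'
  let α : Path p q := ⟨⟨γ, hc⟩, h0, h1⟩
  let β : Path q r := ⟨⟨γ', hc'⟩, h0', h1'⟩
  have hα : Monotone α.extend := hm.comp (monotone_projIcc _)
  have hβ : Monotone β.extend := hm'.comp (monotone_projIcc _)
  refine ⟨α.trans β, (α.trans β).continuous, fun u v huv => ?_, (α.trans β).source,
    (α.trans β).target, fun u => ?_⟩
  · have huv' : (u : ℝ) ≤ v := huv
    show (if (u : ℝ) ≤ 1 / 2 then α.extend (2 * u) else β.extend (2 * u - 1)) ≤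
      (if (v : ℝ) ≤ 1 / 2 then α.extend (2 * v) else β.extend (2 * v - 1))
    split_ifs with hu hv hv
    · exact hα (by linarith)
    · calc α.extend (2 * u) ≤ α.extend 1 := hα (by linarith)
        _ = β.extend 0 := by simp
        _ ≤ β.extend (2 * v - 1) := hβ (by linarith)
    · exact absurd (huv'.trans hv) hu
    · exact hβ (by linarith)
  · show (if (u : ℝ) ≤ 1 / 2 then α.extend (2 * u) else β.extend (2 * u - 1)) ∈ A
    split_ifs
    · exact hγ _
    · exact hγ' _

end HasMonotonePath

lemma Convex.hasMonotonePath {K : Set (ℝ × ℝ)} (hK : Convex ℝ K) {p q : ℝ × ℝ} (hp : p ∈ K)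
    (hq : q ∈ K) (hpq : p ≤ q) : HasMonotonePath K p q := by
  refine ⟨fun u => AffineMap.lineMap p q (u : ℝ), ?_, fun u v huv => ?_, by simp, by simp,
    fun u => hK.segment_subset hp hq ?_⟩
  · simp only [AffineMap.lineMap_apply]
    fun_prop
  · have huv' : (u : ℝ) ≤ v := huv
    have h1 := hpq.1
    have h2 := hpq.2
    constructor
    · simp only [AffineMap.lineMap_apply, vsub_eq_sub, vadd_eq_add, Prod.fst_add, Prod.smul_fst,
        Prod.fst_sub, smul_eq_mul]
      nlinarith
    · simp only [AffineMap.lineMap_apply, vsub_eq_sub, vadd_eq_add, Prod.snd_add, Prod.smul_snd,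
        Prod.snd_sub, smul_eq_mul]
      nlinarith
  · rw [segment_eq_image_lineMap]
    exact ⟨u, u.2, rfl⟩

lemma mem_mirror {c : ℝ} {B : Set (ℝ × ℝ)} {q : ℝ × ℝ} : q ∈ mirror c B ↔ (q.1, c - q.2) ∈ B :=
  Iff.rfl

lemma mirror_mirror (c : ℝ) (B : Set (ℝ × ℝ)) : mirror c (mirror c B) = B := by
  ext q
  simp [mem_mirror]

/-- A horizontal path stays monotone in the mirror image. -/
lemma HasMonotonePath.mirror_horizontal {A : Set (ℝ × ℝ)} {x x' y : ℝ} (c : ℝ)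
    (h : HasMonotonePath A (x, y) (x', y)) :
    HasMonotonePath (mirror c A) (x, c - y) (x', c - y) := by
  obtain ⟨γ, hc, hm, h0, h1, hγ⟩ := h
  have hy : ∀ u, (γ u).2 = y := fun u =>
    le_antisymm ((hm unitInterval.le_one').2.trans_eq (by rw [h1]))
      ((show y = (γ 0).2 by rw [h0]).trans_le (hm unitInterval.nonneg').2)
  refine ⟨fun u => ((γ u).1, c - y), by fun_prop, fun u v huv => ⟨(hm huv).1, le_rfl⟩, by simp [h0],
    by simp [h1], fun u => ?_⟩
  have := hγ u
  rw [← hy u]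
  simpa [mem_mirror] using this

/-- A monotone path in the free space bounds the Fréchet distance of the subcurves. -/
lemma frechetDist_le_of_hasMonotonePath {d : ℕ} {P S : PolyCurve d} {δ a b y z : ℝ}
    (h : HasMonotonePath (freeSpace P S δ) (a, y) (b, z)) :
    frechetDist (subcurve P.toFun a b) (subcurve S.toFun y z) ≤ δ := by
  have hab : a ≤ b := h.le.1
  have hyz : y ≤ z := h.le.2
  obtain ⟨γ, hc, hm, h0, h1, hγ⟩ := h
  -- a coordinate of the path, rescaled to a reparametrization of the unit interval
  have key : ∀ (f : unitInterval → ℝ) (s t : ℝ), Continuous f → Monotone f → f 0 = s → f 1 = t →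
      s ≤ t → ∃ g : unitInterval → unitInterval, Monotone g ∧ Function.Surjective g ∧
        ∀ u, AffineMap.lineMap s t (g u : ℝ) = f u := by
    intro f s t hf hfm hf0 hf1 hst
    have hs : ∀ u, s ≤ f u := fun u => hf0 ▸ hfm unitInterval.nonneg'
    have ht : ∀ u, f u ≤ t := fun u => hf1 ▸ hfm unitInterval.le_one'
    rcases hst.lt_or_eq with hst | rfl
    · have hpos := sub_pos.2 hst
      have hmem : ∀ u, (f u - s) / (t - s) ∈ Icc (0 : ℝ) 1 := fun u =>
        ⟨div_nonneg (by linarith [hs u]) hpos.le, (div_le_one hpos).2 (by linarith [ht u])⟩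
      have hgc : Continuous fun u => (⟨_, hmem u⟩ : unitInterval) :=
        Continuous.subtype_mk (by fun_prop) _
      refine ⟨fun u => ⟨_, hmem u⟩, fun u v huv => ?_, fun y =>
        mem_range_of_exists_le_of_exists_ge hgc ⟨0, ?_⟩ ⟨1, ?_⟩, fun u => ?_⟩
      · exact div_le_div_of_nonneg_right (sub_le_sub_right (hfm huv) _) hpos.le
      · exact Subtype.coe_le_coe.1 (by simpa [hf0] using y.2.1)
      · exact Subtype.coe_le_coe.1 (by simpa [hf1, hpos.ne'] using y.2.2)
      · rw [AffineMap.lineMap_apply_ring']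
        field_simp
        ring
    · exact ⟨id, monotone_id, Function.surjective_id, fun u => by
        rw [AffineMap.lineMap_same_apply]
        exact le_antisymm (hs u) (ht u)⟩
  obtain ⟨f, hf, hf', hfe⟩ := key (fun u => (γ u).1) a b (by fun_prop) (fun u v huv => (hm huv).1)
    (by simp [h0]) (by simp [h1]) hab
  obtain ⟨g, hg, hg', hge⟩ := key (fun u => (γ u).2) y z (by fun_prop) (fun u v huv => (hm huv).2)
    (by simp [h0]) (by simp [h1]) hyz
  refine frechetDist_le f g hf hf' hg hg' fun u => ?_
  simp only [subcurve, hfe, hge]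
  exact (hγ u).2.2

/-- Subcurves within Fréchet distance `δ` are joined by a monotone path in the free space. -/
lemma hasMonotonePath_of_frechetDist_le {d : ℕ} {P S : PolyCurve d} {δ a b y z : ℝ}
    (ha : 0 ≤ a) (hab : a ≤ b) (hb : b ≤ 1) (hy : 0 ≤ y) (hyz : y ≤ z) (hz : z ≤ 1)
    (h : frechetDist (subcurve P.toFun a b) (subcurve S.toFun y z) ≤ δ) :
    HasMonotonePath (freeSpace P S δ) (a, y) (b, z) := by
  obtain ⟨f, g, hf, hg, hfc, hgc, hf0, hf1, hg0, hg1, hfg⟩ := exists_matching_of_frechetDist_le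
    (continuousOn_subcurve P.continuousOn ha hab hb)
    (continuousOn_subcurve S.continuousOn hy hyz hz) h
  have hmono : ∀ {s t : ℝ}, s ≤ t → ∀ {u v : ℝ}, u ≤ v →
      AffineMap.lineMap s t u ≤ AffineMap.lineMap s t v := by
    intro s t hst u v huv
    rw [AffineMap.lineMap_apply_ring', AffineMap.lineMap_apply_ring']
    nlinarith
  refine ⟨fun u => (AffineMap.lineMap a b (f u : ℝ), AffineMap.lineMap y z (g u : ℝ)), ?_,
    fun u v huv => ⟨hmono hab (hf huv), hmono hyz (hg huv)⟩, by simp [hf0, hg0],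
    by simp [hf1, hg1], fun u => ?_⟩
  · simp only [AffineMap.lineMap_apply_ring']
    fun_prop
  · have h1 := lineMap_mem_Icc hab (f u).2
    have h2 := lineMap_mem_Icc hyz (g u).2
    exact ⟨⟨ha.trans h1.1, h1.2.trans hb⟩, ⟨hy.trans h2.1, h2.2.trans hz⟩, hfg u⟩

/-! ### Convex compact cells -/

section Cell

variable {K : Set (ℝ × ℝ)} {s t y : ℝ}

lemma IsCompact.row (hK : IsCompact K) (y : ℝ) : IsCompact (row K y) := by
  have h : _root_.row K y = Prod.fst '' (K ∩ {q | q.2 = y}) := by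
    ext x
    constructor
    · intro hx
      exact ⟨(x, y), ⟨hx, rfl⟩, rfl⟩
    · rintro ⟨⟨x, y⟩, ⟨hx, rfl⟩, rfl⟩
      exact hx
  rw [h]
  exact (hK.inter_right (isClosed_eq continuous_snd continuous_const)).image continuous_fst

lemma leftAt_mem (hK : IsCompact K) (h : (row K y).Nonempty) : (leftAt K y, y) ∈ K :=
  (hK.row y).sInf_mem h

lemma rightAt_mem (hK : IsCompact K) (h : (row K y).Nonempty) : (rightAt K y, y) ∈ K :=
  (hK.row y).sSup_mem h

lemma leftAt_le (hK : IsCompact K) {x : ℝ} (h : (x, y) ∈ K) : leftAt K y ≤ x :=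
  csInf_le (hK.row y).bddBelow h

lemma le_rightAt (hK : IsCompact K) {x : ℝ} (h : (x, y) ∈ K) : x ≤ rightAt K y :=
  le_csSup (hK.row y).bddAbove h

/-- A segment in a convex set meets every height between those of its ends. -/
lemma Convex.exists_mem_row (hK : Convex ℝ K) {p q : ℝ × ℝ} (hp : p ∈ K) (hq : q ∈ K)
    (hy : y ∈ Icc p.2 q.2) : ∃ x ∈ row K y, min p.1 q.1 ≤ x ∧ x ≤ max p.1 q.1 := by
  have h2 : y ∈ Prod.snd '' segment ℝ p q := by
    have hc : IsPreconnected (Prod.snd '' segment ℝ p q) :=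
      (convex_segment p q).isPreconnected.image _ continuous_snd.continuousOn
    exact hc.Icc_subset ⟨p, left_mem_segment ℝ p q, rfl⟩ ⟨q, right_mem_segment ℝ p q, rfl⟩ hy
  obtain ⟨z, hz, rfl⟩ := h2
  refine ⟨z.1, hK.segment_subset hp hq hz, ?_⟩
  have h3 : z.1 ∈ segment ℝ p.1 q.1 := by
    have := image_segment ℝ (LinearMap.fst ℝ ℝ ℝ).toAffineMap p q
    simp only [LinearMap.coe_toAffineMap, LinearMap.fst_apply] at this
    rw [← this]
    exact ⟨z, hz, rfl⟩
  rw [segment_eq_uIcc] at h3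
  exact h3

/-- Minimize `f` and then, among the minimizers, `g`. -/
lemma IsCompact.exists_lex_min (hK : IsCompact K) (hne : K.Nonempty) {f g : ℝ × ℝ → ℝ}
    (hf : Continuous f) (hg : Continuous g) :
    ∃ q ∈ K, (∀ p ∈ K, f q ≤ f p) ∧ ∀ p ∈ K, f p = f q → g q ≤ g p := by
  obtain ⟨q₀, hq₀, h₀⟩ := hK.exists_isMinOn hne hf.continuousOn
  obtain ⟨q, hq, h⟩ :=
    (hK.inter_right (isClosed_eq hf (continuous_const (y := f q₀)))).exists_isMinOn
    ⟨q₀, hq₀, rfl⟩ hg.continuousOn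
  have hfq : f q = f q₀ := hq.2
  exact ⟨q, hq.1, fun p hp => hfq.trans_le (h₀ hp), fun p hp hpq => h ⟨hp, hpq.trans hfq⟩⟩

lemma leftmostPoints_nonempty (hK : IsCompact K) (hne : K.Nonempty) :
    (leftmostPoints K).Nonempty := by
  obtain ⟨q, hq, h, h'⟩ := hK.exists_lex_min hne continuous_fst continuous_snd
  exact ⟨q, hq, h, Or.inl h'⟩

lemma bottommostPoints_nonempty (hK : IsCompact K) (hne : K.Nonempty) :
    (bottommostPoints K).Nonempty := by
  obtain ⟨q, hq, h, h'⟩ := hK.exists_lex_min hne continuous_snd continuous_fst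
  exact ⟨q, hq, h, Or.inl h'⟩

lemma rightmostPoints_nonempty (hK : IsCompact K) (hne : K.Nonempty) :
    (rightmostPoints K).Nonempty := by
  obtain ⟨q, hq, h, h'⟩ := hK.exists_lex_min hne continuous_fst.neg continuous_snd
  exact ⟨q, hq, fun p hp => neg_le_neg_iff.1 (h p hp), Or.inl fun p hp hpq => h' p hp (by simpa)⟩

lemma topmostPoints_nonempty (hK : IsCompact K) (hne : K.Nonempty) :
    (topmostPoints K).Nonempty := by
  obtain ⟨q, hq, h, h'⟩ := hK.exists_lex_min hne continuous_snd.neg continuous_fst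
  exact ⟨q, hq, fun p hp => neg_le_neg_iff.1 (h p hp), Or.inl fun p hp hpq => h' p hp (by simpa)⟩

lemma mem_topmostPoints_mirror {c : ℝ} {q : ℝ × ℝ} (hq : q ∈ bottommostPoints K) :
    (q.1, c - q.2) ∈ topmostPoints (mirror c K) := by
  refine ⟨by simpa [mem_mirror] using hq.1, fun p hp => ?_, hq.2.2.imp ?_ ?_⟩
  · have := hq.2.1 _ hp
    simp only at this ⊢
    linarith
  all_goals
    intro h p hp hpq
    exact h (p.1, c - p.2) hp (by simp only at hpq ⊢; linarith)

lemma mem_bottommostPoints_mirror {c : ℝ} {q : ℝ × ℝ} (hq : q ∈ topmostPoints K) :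
    (q.1, c - q.2) ∈ bottommostPoints (mirror c K) := by
  refine ⟨by simpa [mem_mirror] using hq.1, fun p hp => ?_, hq.2.2.imp ?_ ?_⟩
  · have := hq.2.1 _ hp
    simp only at this ⊢
    linarith
  all_goals
    intro h p hp hpq
    exact h (p.1, c - p.2) hp (by simp only at hpq ⊢; linarith)

/-- A cell that is bad for a subedge is good for the reversed subedge. -/
lemma IsBad.not_isBad_mirror (hK : IsCompact K) (h : IsBad K s t) (c : ℝ) {s' t' : ℝ} :
    ¬ IsBad (mirror c K) s' t' := by
  intro h'
  have hne : K.Nonempty := ⟨_, h.1.some_mem⟩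
  obtain ⟨p, hp⟩ := topmostPoints_nonempty hK hne
  obtain ⟨q, hq⟩ := bottommostPoints_nonempty hK hne
  have h1 := h.2.2.2.2 p hp q hq
  have h2 := h'.2.2.2.2 _ (mem_topmostPoints_mirror hq) _ (mem_bottommostPoints_mirror hp)
  exact lt_asymm h1 h2

/-- In a bad cell the left boundary recedes on the way up: the topmost points, which are above
height `t`, are not to the right of `leftAt K s`. -/
lemma IsBad.leftAt_le_leftAt (hc : Convex ℝ K) (hK : IsCompact K) (h : IsBad K s t)
    (hst : s ≤ t) : leftAt K t ≤ leftAt K s := by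
  obtain ⟨p, hp⟩ := topmostPoints_nonempty hK ⟨_, h.1.some_mem⟩
  obtain ⟨x, hx, -, hx'⟩ := hc.exists_mem_row (leftAt_mem hK h.1) hp.1
    (y := t) ⟨hst, hp.2.1 _ h.2.1.some_mem⟩
  exact (leftAt_le hK hx).trans (hx'.trans (max_le le_rfl (h.2.2.1 p hp).1))

lemma IsBad.rightAt_le_rightAt (hc : Convex ℝ K) (hK : IsCompact K) (h : IsBad K s t)
    (hst : s ≤ t) : rightAt K t ≤ rightAt K s := by
  obtain ⟨p, hp⟩ := bottommostPoints_nonempty hK ⟨_, h.1.some_mem⟩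
  obtain ⟨x, hx, hx', -⟩ := hc.exists_mem_row hp.1 (rightAt_mem hK h.2.1)
    (y := s) ⟨hp.2.1 _ h.1.some_mem, hst⟩
  exact (le_min (h.2.2.2.1 p hp).2 le_rfl).trans (hx'.trans (le_rightAt hK hx))

end Cell

/-! ### What the proxy coverage of a subedge and its reversal contains -/

section Proxy

variable {d : ℕ} {P : PolyCurve d} {B : Set (ℝ × ℝ)} {s t : ℝ}

/-- `B` is a set of points over `P`, such as the part of an approximate free space over one edge of
`S`, all of whose columns are convex and compact. -/
structure IsCellwiseConvex (P : PolyCurve d) (B : Set (ℝ × ℝ)) : Prop where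
  convex : ∀ i, Convex ℝ (column P B i)
  compact : ∀ i, IsCompact (column P B i)
  fst_mem : ∀ q ∈ B, q.1 ∈ Icc (0 : ℝ) 1

lemma IsCellwiseConvex.mirror (hB : IsCellwiseConvex P B) (c : ℝ) :
    IsCellwiseConvex P (mirror c B) := by
  refine ⟨fun i p hp q hq a b ha hb hab => ?_, fun i => ?_,
    fun q hq => hB.fst_mem (q.1, c - q.2) hq⟩
  · have := hB.convex i hp hq ha hb hab
    have e : (a • (p.1, c - p.2) + b • (q.1, c - q.2) : ℝ × ℝ) =
        ((a • p + b • q).1, c - (a • p + b • q).2) := by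
      ext
      · simp
      · simp only [Prod.smul_mk, Prod.mk_add_mk, Prod.snd_add, Prod.smul_snd, smul_eq_mul]
        linear_combination c * hab
    show ((a • p + b • q).1, c - (a • p + b • q).2) ∈ column P B i
    rw [← e]
    exact this
  · have e : column P (_root_.mirror c B) i =
        (fun q : ℝ × ℝ => (q.1, c - q.2)) '' column P B i := by
      ext q
      constructor
      · intro hq
        exact ⟨(q.1, c - q.2), hq, by simp⟩
      · rintro ⟨q, hq, rfl⟩
        exact ⟨by simpa [mem_mirror] using hq.1, hq.2⟩
    rw [e]
    exact (hB.compact i).image (by fun_prop)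

/-- The union of the proxy coverages of a subedge and of its reversal. -/
def twoWayProxy (P : PolyCurve d) (c : ℝ) (B : Set (ℝ × ℝ)) (s t : ℝ) : Set ℝ :=
  subedgeProxy P B s t ∪ subedgeProxy P (mirror c B) (c - t) (c - s)

lemma twoWayProxy_mirror (c : ℝ) :
    twoWayProxy P c (mirror c B) (c - t) (c - s) = twoWayProxy P c B s t := by
  simp only [twoWayProxy, mirror_mirror, sub_sub_cancel, union_comm]

/-- In a finite set of index pairs every pair is included in a maximal one: one of maximal length
among those that include it. -/
lemma exists_mem_maximalPairs {n : ℕ} {M : Set (Fin n × Fin n)} {p : Fin n × Fin n} (hp : p ∈ M) :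
    ∃ q ∈ maximalPairs M, q.1 ≤ p.1 ∧ p.2 ≤ q.2 := by
  obtain ⟨q, ⟨hq, hq1, hq2⟩, hmax⟩ :=
    (Set.toFinite {q | q ∈ M ∧ q.1 ≤ p.1 ∧ p.2 ≤ q.2}).exists_maximalFor
    (fun q => (q.2 : ℤ) - q.1) _ ⟨p, hp, le_rfl, le_rfl⟩
  refine ⟨q, ⟨hq, fun r hr h1 h2 => ?_⟩, hq1, hq2⟩
  have := hmax (j := r) ⟨hr, h1.trans hq1, hq2.trans h2⟩
  simp only [Fin.le_def] at this h1 h2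
  ext <;> omega

/-- A pair of cells joined by a path is a local pair of the combinatorial representation or is
included in a pair of the reduced global group. -/
lemma exists_dominating_pair {p : Fin P.edges × Fin P.edges} (hp : p ∈ pathPairs P B s t)
    (hle : p.1 ≤ p.2) : (p.1 = p.2 ∧ p ∈ combRep P B s t) ∨
      ∃ q ∈ reducedGlobalGroup P B s t, q.1 ≤ p.1 ∧ p.2 ≤ q.2 := by
  obtain ⟨q, hq, h1, h2⟩ := exists_mem_maximalPairs hp
  rcases ((h1.trans hle).trans h2).lt_or_eq with h | h
  · obtain ⟨r, hr, h3, h4⟩ := exists_mem_maximalPairs (M := {p | IsMerged P B s t p})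
      (IsMerged.base q ⟨hq, h⟩)
    exact Or.inr ⟨r, hr, h3.trans h1, h2.trans h4⟩
  · have e1 : q.1 = p.1 := le_antisymm h1 (by rw [h]; exact hle.trans h2)
    have e2 : q.2 = p.2 := le_antisymm (by rw [← h]; exact h1.trans hle) h2
    have e : q = p := Prod.ext e1 e2
    exact Or.inl ⟨by rw [← e1, ← e2, h], e ▸ hq⟩

lemma IsMerged.nonempty {p : Fin P.edges × Fin P.edges} (h : IsMerged P B s t p) :
    (row (column P B p.1) s).Nonempty ∧ (row (column P B p.2) t).Nonempty := by
  induction h with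
  | base p hp =>
    obtain ⟨a, ha, b, hb, hab⟩ := hp.1.1
    exact ⟨⟨a, hab.left_mem, ha⟩, ⟨b, hab.right_mem, hb⟩⟩
  | merge p q _ _ _ hp hq => exact ⟨hp.1, hq.2⟩

lemma leftHat_mem (hB : IsCellwiseConvex P B) {i : Fin P.edges}
    (h : (row (column P B i) s).Nonempty) :
    leftHat (column P B i) s t ∈ Icc (P.knot i.castSucc) (P.knot i.succ) := by
  unfold leftHat
  split_ifs
  · exact (rightAt_mem (hB.compact i) h).2
  · exact (leftAt_mem (hB.compact i) h).2

lemma rightHat_mem (hB : IsCellwiseConvex P B) {i : Fin P.edges}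
    (h : (row (column P B i) t).Nonempty) :
    rightHat (column P B i) s t ∈ Icc (P.knot i.castSucc) (P.knot i.succ) := by
  unfold rightHat
  split_ifs
  · exact (leftAt_mem (hB.compact i) h).2
  · exact (rightAt_mem (hB.compact i) h).2

lemma leftHat_le (hB : IsCellwiseConvex P B) {i j : Fin P.edges} (hji : j ≤ i) {x : ℝ}
    (h : (row (column P B j) s).Nonempty) (hx : P.knot i.castSucc ≤ x)
    (hx' : leftHat (column P B i) s t ≤ x) : leftHat (column P B j) s t ≤ x := by
  rcases hji.lt_or_eq with hlt | rfl
  · exact (leftHat_mem hB h).2.trans ((P.knot_succ_le_castSucc hlt).trans hx)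
  · exact hx'

lemma le_rightHat (hB : IsCellwiseConvex P B) {i j : Fin P.edges} (hij : i ≤ j) {x : ℝ}
    (h : (row (column P B j) t).Nonempty) (hx : x ≤ P.knot i.succ)
    (hx' : x ≤ rightHat (column P B i) s t) : x ≤ rightHat (column P B j) s t := by
  rcases hij.lt_or_eq with hlt | rfl
  · exact hx.trans ((P.knot_succ_le_castSucc hlt).trans (rightHat_mem hB h).1)
  · exact hx'

lemma mem_subedgeProxy_of_reduced (hB : IsCellwiseConvex P B) {i j : Fin P.edges}
    {q : Fin P.edges × Fin P.edges} (hq : q ∈ reducedGlobalGroup P B s t) (h1 : q.1 ≤ i)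
    (h2 : j ≤ q.2) {x : ℝ} (hx : P.knot i.castSucc ≤ x) (hx' : x ≤ P.knot j.succ)
    (hl : leftHat (column P B i) s t ≤ x) (hr : x ≤ rightHat (column P B j) s t) :
    x ∈ subedgeProxy P B s t :=
  Or.inr ⟨q, hq, leftHat_le hB h1 (IsMerged.nonempty hq.1).1 hx hl,
    le_rightHat hB h2 (IsMerged.nonempty hq.1).2 hx' hr⟩

/-- In a good cell all that is between the left end of the row at height `s` and the right end of
the row at height `t` is in the proxy coverage, whether the cell forms a local pair or is included
in a global one. -/
lemma subedgeProxy_of_not_isBad (hB : IsCellwiseConvex P B) (hst : s ≤ t) {i : Fin P.edges}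
    (hs : (row (column P B i) s).Nonempty) (ht : (row (column P B i) t).Nonempty)
    (hgood : ¬ IsBad (column P B i) s t) :
    Icc (leftAt (column P B i) s) (rightAt (column P B i) t) ⊆ subedgeProxy P B s t := by
  intro x hx
  have hl := leftAt_mem (hB.compact i) hs
  have hr := rightAt_mem (hB.compact i) ht
  have hp : (i, i) ∈ pathPairs P B s t := by
    refine ⟨_, hl.2, _, hr.2, ?_⟩
    exact ((hB.convex i).hasMonotonePath hl hr ⟨hx.1.trans hx.2, hst⟩).mono fun q hq => hq.1.1
  rcases exists_dominating_pair hp le_rfl with ⟨-, h⟩ | ⟨q, hq, h1, h2⟩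
  · exact Or.inl ⟨i, h, hgood, hx⟩
  · refine mem_subedgeProxy_of_reduced hB hq h1 h2 (hl.2.1.trans hx.1) (hx.2.trans hr.2.2) ?_ ?_
    · rw [leftHat, if_neg hgood]
      exact hx.1
    · rw [rightHat, if_neg hgood]
      exact hx.2

/-- For a bad cell the reversal of the subedge takes over. -/
lemma Icc_subset_twoWayProxy (hB : IsCellwiseConvex P B) (c : ℝ) (hst : s ≤ t) {i : Fin P.edges}
    (hs : (row (column P B i) s).Nonempty) (ht : (row (column P B i) t).Nonempty) :
    Icc (leftAt (column P B i) s) (rightAt (column P B i) t) ⊆ twoWayProxy P c B s t := by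
  by_cases h : IsBad (column P B i) s t
  · have hgood : ¬ IsBad (column P (mirror c B) i) (c - t) (c - s) :=
      h.not_isBad_mirror (hB.compact i) c
    have hs' : (row (column P (mirror c B) i) (c - s)).Nonempty := by
      have e : row (column P (mirror c B) i) (c - s) = row (column P B i) (c - (c - s)) := rfl
      rwa [e, sub_sub_cancel]
    have ht' : (row (column P (mirror c B) i) (c - t)).Nonempty := by
      have e : row (column P (mirror c B) i) (c - t) = row (column P B i) (c - (c - t)) := rfl
      rwa [e, sub_sub_cancel]
    have key := subedgeProxy_of_not_isBad (hB.mirror c) (by linarith) ht' hs' hgood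
    have e1 : leftAt (column P (mirror c B) i) (c - t) = leftAt (column P B i) (c - (c - t)) := rfl
    have e2 : rightAt (column P (mirror c B) i) (c - s) =
      rightAt (column P B i) (c - (c - s)) := rfl
    rw [e1, e2, sub_sub_cancel, sub_sub_cancel] at key
    exact (Icc_subset_Icc (h.leftAt_le_leftAt (hB.convex i) (hB.compact i) hst)
      (h.rightAt_le_rightAt (hB.convex i) (hB.compact i) hst)).trans
      (key.trans subset_union_right)
  · exact (subedgeProxy_of_not_isBad hB hst hs ht h).trans subset_union_left

/-- The mirror image of `Icc_subset_twoWayProxy`. -/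
lemma Icc_subset_twoWayProxy_reversed (hB : IsCellwiseConvex P B) (c : ℝ) (hst : s ≤ t)
    {i : Fin P.edges}
    (hs : (row (column P B i) s).Nonempty) (ht : (row (column P B i) t).Nonempty) :
    Icc (leftAt (column P B i) t) (rightAt (column P B i) s) ⊆ twoWayProxy P c B s t := by
  have e : ∀ y, row (column P (mirror c B) i) (c - y) = row (column P B i) y := fun y => by
    show row (column P B i) (c - (c - y)) = _
    rw [sub_sub_cancel]
  have key := Icc_subset_twoWayProxy (hB.mirror c) c (s := c - t) (t := c - s) (by linarith)
    (i := i) (by rwa [e]) (by rwa [e])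
  rw [twoWayProxy_mirror] at key
  simpa only [leftAt, rightAt, e] using key

/-- A point between the outermost of the four row ends at heights `s` and `t` is covered. -/
lemma mem_twoWayProxy_of_column (hB : IsCellwiseConvex P B) (c : ℝ) (hst : s ≤ t)
    {i : Fin P.edges} (hs : (row (column P B i) s).Nonempty)
    (ht : (row (column P B i) t).Nonempty) {x : ℝ}
    (hl : leftAt (column P B i) s ≤ x ∨ leftAt (column P B i) t ≤ x)
    (hr : x ≤ rightAt (column P B i) s ∨ x ≤ rightAt (column P B i) t) :
    x ∈ twoWayProxy P c B s t := by
  have h1 := Icc_subset_twoWayProxy hB c hst hs ht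
  have h2 := Icc_subset_twoWayProxy_reversed hB c hst hs ht
  have hs' := leftAt_le (hB.compact i) (rightAt_mem (hB.compact i) hs)
  have ht' := leftAt_le (hB.compact i) (rightAt_mem (hB.compact i) ht)
  rcases hl with hl | hl <;> rcases hr with hr | hr
  · rcases le_total x (rightAt (column P B i) t) with h | h
    · exact h1 ⟨hl, h⟩
    · exact h2 ⟨ht'.trans h, hr⟩
  · exact h1 ⟨hl, hr⟩
  · exact h2 ⟨hl, hr⟩
  · rcases le_total x (rightAt (column P B i) s) with h | h
    · exact h2 ⟨hl, h⟩
    · exact h1 ⟨hs'.trans h, hr⟩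

lemma mem_twoWayProxy_of_row (hB : IsCellwiseConvex P B) (c : ℝ) (hst : s ≤ t)
    {i : Fin P.edges} (hs : (row (column P B i) s).Nonempty)
    (ht : (row (column P B i) t).Nonempty) {x : ℝ}
    (hx : (x, s) ∈ column P B i ∨ (x, t) ∈ column P B i) : x ∈ twoWayProxy P c B s t :=
  hx.elim
    (fun hx => mem_twoWayProxy_of_column hB c hst hs ht (Or.inl (leftAt_le (hB.compact i) hx))
      (Or.inl (le_rightAt (hB.compact i) hx)))
    (fun hx => mem_twoWayProxy_of_column hB c hst hs ht (Or.inr (leftAt_le (hB.compact i) hx))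
      (Or.inr (le_rightAt (hB.compact i) hx)))

/-- Whatever a monotone path from height `s` to height `t` passes over is covered by the proxy
coverages of the subedge and its reversal. -/
lemma HasMonotonePath.Icc_subset_twoWayProxy (hB : IsCellwiseConvex P B) (c : ℝ) {a b : ℝ}
    (h : HasMonotonePath B (a, s) (b, t)) : Icc a b ⊆ twoWayProxy P c B s t := by
  have hst : s ≤ t := h.le.2
  intro x hx
  obtain ⟨i, hi⟩ := P.exists_edge (hB.fst_mem _ h.left_mem)
  -- if `j < i`, then `a = b` is on the common border of the two cells, and `i` serves for both
  obtain ⟨j, hj, hij⟩ : ∃ j : Fin P.edges, b ∈ Icc (P.knot j.castSucc) (P.knot j.succ) ∧ i ≤ j := by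
    obtain ⟨j, hj⟩ := P.exists_edge (hB.fst_mem _ h.right_mem)
    rcases le_or_gt i j with hij | hij
    · exact ⟨j, hj, hij⟩
    · exact ⟨i, ⟨hi.1.trans h.le.1, hj.2.trans ((P.knot_succ_le_castSucc hij).trans
        (P.knot_castSucc_lt_succ i).le)⟩, le_rfl⟩
  have ha : (a, s) ∈ column P B i := ⟨h.left_mem, hi⟩
  have hb : (b, t) ∈ column P B j := ⟨h.right_mem, hj⟩
  rcases exists_dominating_pair (p := (i, j)) ⟨a, hi, b, hj, h⟩ hij with ⟨e, -⟩ | ⟨q, hq, h1, h2⟩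
  · obtain rfl : i = j := e
    exact _root_.Icc_subset_twoWayProxy hB c hst ⟨a, ha⟩ ⟨b, hb⟩
      ⟨(leftAt_le (hB.compact i) ha).trans hx.1, hx.2.trans (le_rightAt (hB.compact i) hb)⟩
  -- if `x` is outside the interval of `q`, one of the end cells is bad and contains `x`
  by_cases hl : leftHat (column P B i) s t ≤ x
  · by_cases hr : x ≤ rightHat (column P B j) s t
    · exact Or.inl (mem_subedgeProxy_of_reduced hB hq h1 h2 (hi.1.trans hx.1) (hx.2.trans hj.2)
        hl hr)
    · have hbad : IsBad (column P B j) s t := by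
        by_contra hgood
        rw [rightHat, if_neg hgood] at hr
        exact hr (hx.2.trans (le_rightAt (hB.compact j) hb))
      rw [rightHat, if_pos hbad] at hr
      exact mem_twoWayProxy_of_column hB c hst hbad.1 hbad.2.1 (Or.inr (not_le.1 hr).le)
        (Or.inr (hx.2.trans (le_rightAt (hB.compact j) hb)))
  · have hbad : IsBad (column P B i) s t := by
      by_contra hgood
      rw [leftHat, if_neg hgood] at hl
      exact hl ((leftAt_le (hB.compact i) ha).trans hx.1)
    rw [leftHat, if_pos hbad] at hl
    exact mem_twoWayProxy_of_column hB c hst hbad.1 hbad.2.1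
      (Or.inl ((leftAt_le (hB.compact i) ha).trans hx.1)) (Or.inl (not_le.1 hl).le)

end Proxy

/-! ### Gaps between consecutive heights -/

section Gap

variable {d : ℕ} {P : PolyCurve d} {B : Set (ℝ × ℝ)} {H : Finset ℝ} {u v : ℝ}

/-- `u < v` are consecutive elements of `H`. -/
structure IsGap (H : Finset ℝ) (u v : ℝ) : Prop where
  left_mem : u ∈ H
  right_mem : v ∈ H
  lt : u < v
  le_or_le : ∀ h ∈ H, h ≤ u ∨ v ≤ h

/-- The finite set `H` contains the heights of all extremal points of `B`. -/
def ContainsExtremalHeights (P : PolyCurve d) (B : Set (ℝ × ℝ)) (H : Finset ℝ) : Prop :=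
  ∀ i, ∀ q ∈ extremalPoints (column P B i), q.2 ∈ H

/-- A cell that has points below the top of a gap and points not below its bottom has points at its
bottom height, because its lowest height is in `H`. -/
lemma row_left_nonempty (hB : IsCellwiseConvex P B) (hH : ContainsExtremalHeights P B H)
    (hg : IsGap H u v) {i : Fin P.edges} {p q : ℝ × ℝ} (hp : p ∈ column P B i)
    (hq : q ∈ column P B i) (hpv : p.2 < v) (hqu : u ≤ q.2) : (row (column P B i) u).Nonempty := by
  obtain ⟨r, hr⟩ := bottommostPoints_nonempty (hB.compact i) ⟨p, hp⟩
  have h1 : r.2 ∈ H := hH i r (Or.inl (Or.inr hr))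
  have h2 : r.2 ≤ u := (hg.le_or_le _ h1).resolve_right
    (not_le.2 ((hr.2.1 p hp).trans_lt hpv))
  obtain ⟨x, hx, -⟩ := (hB.convex i).exists_mem_row hr.1 hq ⟨h2, hqu⟩
  exact ⟨x, hx⟩

lemma row_right_nonempty (hB : IsCellwiseConvex P B) (hH : ContainsExtremalHeights P B H)
    (hg : IsGap H u v) {i : Fin P.edges} {p q : ℝ × ℝ} (hp : p ∈ column P B i)
    (hq : q ∈ column P B i) (hpu : u < p.2) (hqv : q.2 ≤ v) : (row (column P B i) v).Nonempty := by
  obtain ⟨r, hr⟩ := topmostPoints_nonempty (hB.compact i) ⟨p, hp⟩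
  have h1 : r.2 ∈ H := hH i r (Or.inr hr)
  have h2 : v ≤ r.2 := (hg.le_or_le _ h1).resolve_left
    (not_le.2 (hpu.trans_le (hr.2.1 p hp)))
  obtain ⟨x, hx, -⟩ := (hB.convex i).exists_mem_row hq hr.1 ⟨hqv, h2⟩
  exact ⟨x, hx⟩

/-- In a gap the row ends of a cell are monotone functions of the height, so that a point of the
cell lies between the outermost row ends at the two heights bounding the gap. -/
lemma mem_twoWayProxy_of_gap (hB : IsCellwiseConvex P B) (hH : ContainsExtremalHeights P B H)
    (hg : IsGap H u v) (c : ℝ) {i : Fin P.edges} {x y : ℝ} (hx : (x, y) ∈ column P B i)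
    (hu : u < y) (hv : y < v) : x ∈ twoWayProxy P c B u v := by
  refine mem_twoWayProxy_of_column hB c hg.lt.le (row_left_nonempty hB hH hg hx hx hv hu.le)
    (row_right_nonempty hB hH hg hx hx hu hv.le) ?_ ?_
  · obtain ⟨r, hr⟩ := leftmostPoints_nonempty (hB.compact i) ⟨_, hx⟩
    have hrx : r.1 ≤ x := hr.2.1 _ hx
    rcases hg.le_or_le _ (hH i r (Or.inl (Or.inl (Or.inl hr)))) with h | h
    · obtain ⟨z, hz, -, hz'⟩ := (hB.convex i).exists_mem_row hr.1 hx (y := u) ⟨h, hu.le⟩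
      exact Or.inl ((leftAt_le (hB.compact i) hz).trans (hz'.trans (max_le hrx le_rfl)))
    · obtain ⟨z, hz, -, hz'⟩ := (hB.convex i).exists_mem_row hx hr.1 (y := v) ⟨hv.le, h⟩
      exact Or.inr ((leftAt_le (hB.compact i) hz).trans (hz'.trans (max_le le_rfl hrx)))
  · obtain ⟨r, hr⟩ := rightmostPoints_nonempty (hB.compact i) ⟨_, hx⟩
    have hrx : x ≤ r.1 := hr.2.1 _ hx
    rcases hg.le_or_le _ (hH i r (Or.inl (Or.inl (Or.inr hr)))) with h | h
    · obtain ⟨z, hz, hz', -⟩ := (hB.convex i).exists_mem_row hr.1 hx (y := u) ⟨h, hu.le⟩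
      exact Or.inl (((le_min hrx le_rfl).trans hz').trans (le_rightAt (hB.compact i) hz))
    · obtain ⟨z, hz, hz', -⟩ := (hB.convex i).exists_mem_row hx hr.1 (y := v) ⟨hv.le, h⟩
      exact Or.inr (((le_min le_rfl hrx).trans hz').trans (le_rightAt (hB.compact i) hz))

/-- A path that runs to the right at the upper height `v`, starting in a cell with points at both
heights, can be prolonged to the left, down to height `u`. -/
lemma mem_twoWayProxy_of_horizontal_top (c : ℝ) (hB : IsCellwiseConvex P B) (huv : u ≤ v)
    {i : Fin P.edges}
    (hu : (row (column P B i) u).Nonempty) (hv : (row (column P B i) v).Nonempty) {x₁ x : ℝ}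
    (hx₁ : (x₁, v) ∈ column P B i) (h : HasMonotonePath B (x₁, v) (x, v)) :
    x ∈ twoWayProxy P c B u v := by
  have hx₁x : x₁ ≤ x := h.le.1
  rcases le_or_gt x (P.knot i.succ) with hx | hx
  · exact mem_twoWayProxy_of_row hB c huv hu hv
      (Or.inr ⟨h.right_mem, hx₁.2.1.trans hx₁x, hx⟩)
  · -- the path leaves the cell at height `v`; it can be entered from the row at height `u`
    obtain ⟨y, hy, h1, h2⟩ := h.split_fst (x := P.knot i.succ) ⟨hx₁.2.2, hx.le⟩
    obtain rfl : y = v := le_antisymm hy.2 hy.1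
    have hl := leftAt_mem (hB.compact i) hu
    have h3 : HasMonotonePath B (leftAt (column P B i) u, u) (P.knot i.succ, y) :=
      ((hB.convex i).hasMonotonePath hl ⟨h2.left_mem, (P.knot_castSucc_lt_succ i).le, le_rfl⟩
        ⟨hl.2.2, huv⟩).mono fun q hq => hq.1.1
    exact (h3.trans h2).Icc_subset_twoWayProxy hB c ⟨hl.2.2.trans hx.le, le_rfl⟩

/-- A path that arrives from the left at the lower height `u`, ending in a cell with points at both
heights, can be prolonged to the right, up to height `v`. -/
lemma mem_twoWayProxy_of_horizontal_bottom (c : ℝ) (hB : IsCellwiseConvex P B) (huv : u ≤ v)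
    {i : Fin P.edges}
    (hu : (row (column P B i) u).Nonempty) (hv : (row (column P B i) v).Nonempty) {x₁ x : ℝ}
    (hx₁ : (x₁, u) ∈ column P B i) (h : HasMonotonePath B (x, u) (x₁, u)) :
    x ∈ twoWayProxy P c B u v := by
  have hx₁x : x ≤ x₁ := h.le.1
  rcases le_or_gt (P.knot i.castSucc) x with hx | hx
  · exact mem_twoWayProxy_of_row hB c huv hu hv
      (Or.inl ⟨h.left_mem, hx, hx₁x.trans hx₁.2.2⟩)
  · obtain ⟨y, hy, h1, h2⟩ := h.split_fst (x := P.knot i.castSucc) ⟨hx.le, hx₁.2.1⟩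
    obtain rfl : y = u := le_antisymm hy.2 hy.1
    have hr := rightAt_mem (hB.compact i) hv
    have h3 : HasMonotonePath B (P.knot i.castSucc, y) (rightAt (column P B i) v, v) :=
      ((hB.convex i).hasMonotonePath ⟨h2.left_mem, le_rfl, (P.knot_castSucc_lt_succ i).le⟩ hr
        ⟨hr.2.1, huv⟩).mono fun q hq => hq.1.1
    exact (h1.trans h3).Icc_subset_twoWayProxy hB c ⟨le_rfl, hx.le.trans hr.2.1⟩

/-- A horizontal path at one of the heights `u`, `v` is covered if it meets a cell that has points
at both heights. -/
lemma Icc_subset_twoWayProxy_of_horizontal (hB : IsCellwiseConvex P B) (c : ℝ) (huv : u ≤ v)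
    {i : Fin P.edges} (hu : (row (column P B i) u).Nonempty)
    (hv : (row (column P B i) v).Nonempty) {y a b x₁ : ℝ} (hy : y = u ∨ y = v)
    (h : HasMonotonePath B (a, y) (b, y)) (hx₁ : x₁ ∈ Icc a b)
    (hx₁i : (x₁, y) ∈ column P B i) : Icc a b ⊆ twoWayProxy P c B u v := by
  intro x hx
  have e : ∀ y, row (column P (mirror c B) i) (c - y) = row (column P B i) y := fun y => by
    show row (column P B i) (c - (c - y)) = _
    rw [sub_sub_cancel]
  have hu' : (row (column P (mirror c B) i) (c - u)).Nonempty := by rwa [e]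
  have hv' : (row (column P (mirror c B) i) (c - v)).Nonempty := by rwa [e]
  have hx₁' : (x₁, c - y) ∈ column P (mirror c B) i := by
    refine ⟨?_, hx₁i.2⟩
    simpa [mem_mirror] using hx₁i.1
  rcases le_total x₁ x with hle | hle
  · have hp : HasMonotonePath B (x₁, y) (x, y) := by
      obtain ⟨y', hy', -, h2⟩ := h.split_fst hx₁
      obtain rfl : y' = y := le_antisymm hy'.2 hy'.1
      obtain ⟨y'', hy'', h3, -⟩ := h2.split_fst ⟨hle, hx.2⟩
      obtain rfl : y'' = y' := le_antisymm hy''.2 hy''.1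
      exact h3
    rcases hy with rfl | rfl
    · rw [← twoWayProxy_mirror]
      exact mem_twoWayProxy_of_horizontal_top c (hB.mirror c) (by linarith) hv' hu' hx₁'
        (hp.mirror_horizontal c)
    · exact mem_twoWayProxy_of_horizontal_top c hB huv hu hv hx₁i hp
  · have hp : HasMonotonePath B (x, y) (x₁, y) := by
      obtain ⟨y', hy', -, h2⟩ := h.split_fst hx
      obtain rfl : y' = y := le_antisymm hy'.2 hy'.1
      obtain ⟨y'', hy'', h3, -⟩ := h2.split_fst ⟨hle, hx₁.2⟩
      obtain rfl : y'' = y' := le_antisymm hy''.2 hy''.1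
      exact h3
    rcases hy with rfl | rfl
    · exact mem_twoWayProxy_of_horizontal_bottom c hB huv hu hv hx₁i hp
    · rw [← twoWayProxy_mirror]
      exact mem_twoWayProxy_of_horizontal_bottom c (hB.mirror c) (by linarith) hv' hu' hx₁'
        (hp.mirror_horizontal c)

/-- A monotone path between the heights of a gap that does not stay on the boundary of the gap is
covered by the proxy coverages of the subedge spanning the gap and of its reversal. -/
lemma HasMonotonePath.Icc_subset_twoWayProxy_of_gap (hB : IsCellwiseConvex P B)
    (hH : ContainsExtremalHeights P B H) (hg : IsGap H u v) (c : ℝ) {a b y₁ y₂ y : ℝ}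
    (h : HasMonotonePath B (a, y₁) (b, y₂)) (hu : u ≤ y₁) (hv : y₂ ≤ v) (hy : y ∈ Icc y₁ y₂)
    (huy : u < y) (hyv : y < v) : Icc a b ⊆ twoWayProxy P c B u v := by
  intro x hx
  obtain ⟨z, hz, h1, h2⟩ := h.split_fst hx
  have hzu : u ≤ z := hu.trans hz.1
  have hzv : z ≤ v := hz.2.trans hv
  rcases hzv.lt_or_eq with hzv' | rfl
  · rcases hzu.lt_or_eq with hzu' | rfl
    · obtain ⟨i, hi⟩ := P.exists_edge (hB.fst_mem _ h1.right_mem)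
      exact mem_twoWayProxy_of_gap hB hH hg c ⟨h1.right_mem, hi⟩ hzu' hzv'
    · -- the first cell that the remaining path meets inside the gap
      obtain ⟨i, ⟨⟨x', y'⟩, hxi, hy'u, hy'v, hp⟩, hmin⟩ := (Set.toFinite
        {i : Fin P.edges | ∃ q ∈ column P B i, u < q.2 ∧ q.2 < v ∧
          HasMonotonePath B (x, u) q}).exists_minimal (by
        obtain ⟨x', -, h3, -⟩ := h2.split_snd (y := y) ⟨huy.le, hy.2⟩
        obtain ⟨i, hi⟩ := P.exists_edge (hB.fst_mem _ h3.right_mem)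
        exact ⟨i, (x', y), ⟨h3.right_mem, hi⟩, huy, hyv, h3⟩)
      simp only at hy'u hy'v
      have hru := row_left_nonempty hB hH hg hxi hxi hy'v hy'u.le
      have hrv := row_right_nonempty hB hH hg hxi hxi hy'u hy'v.le
      have hxx' : x ≤ x' := hp.le.1
      rcases le_or_gt (P.knot i.castSucc) x with hxl | hxl
      · exact mem_twoWayProxy_of_row hB c hg.lt.le hru hrv
          (Or.inl ⟨hp.left_mem, hxl, hxx'.trans hxi.2.2⟩)
      · obtain ⟨w, hw, h3, h4⟩ := hp.split_fst (x := P.knot i.castSucc) ⟨hxl.le, hxi.2.1⟩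
        have hwi : (P.knot i.castSucc, w) ∈ column P B i :=
          ⟨h3.right_mem, le_rfl, (P.knot_castSucc_lt_succ i).le⟩
        rcases hw.1.eq_or_lt with hwu | hwu
        · simp only at hwu
          subst hwu
          exact mem_twoWayProxy_of_horizontal_bottom c hB hg.lt.le hru hrv hwi h3
        · obtain ⟨k, hk1, hk2⟩ := P.exists_edge_of_pos
            ((hB.fst_mem _ h3.left_mem).1.trans_lt hxl) (P.knot_mem i.castSucc).2
          have hik : i ≤ k := hmin ⟨_, ⟨h3.right_mem, hk1.le, hk2⟩, hwu, hw.2.trans_lt hy'v, h3⟩ (by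
            by_contra hlt
            exact absurd (P.knot_strictMono.monotone
              (Fin.castSucc_le_castSucc_iff.2 (not_le.1 hlt).le)) (not_le.2 hk1))
          exact absurd (P.knot_strictMono.monotone (Fin.castSucc_le_castSucc_iff.2 hik))
            (not_le.2 hk1)
  · -- the last cell that the path meets inside the gap
    obtain ⟨i, ⟨⟨x', y'⟩, hxi, hy'u, hy'v, hp⟩, hmax⟩ := (Set.toFinite
      {i : Fin P.edges | ∃ q ∈ column P B i, u < q.2 ∧ q.2 < z ∧
        HasMonotonePath B q (x, z)}).exists_maximal (by
      obtain ⟨x', -, -, h3⟩ := h1.split_snd (y := y) ⟨hy.1, hyv.le⟩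
      obtain ⟨i, hi⟩ := P.exists_edge (hB.fst_mem _ h3.left_mem)
      exact ⟨i, (x', y), ⟨h3.left_mem, hi⟩, huy, hyv, h3⟩)
    simp only at hy'u hy'v
    have hru := row_left_nonempty hB hH hg hxi hxi hy'v hy'u.le
    have hrv := row_right_nonempty hB hH hg hxi hxi hy'u hy'v.le
    have hxx' : x' ≤ x := hp.le.1
    rcases le_or_gt x (P.knot i.succ) with hxl | hxl
    · exact mem_twoWayProxy_of_row hB c hg.lt.le hru hrv
        (Or.inr ⟨hp.right_mem, hxi.2.1.trans hxx', hxl⟩)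
    · obtain ⟨w, hw, h3, h4⟩ := hp.split_fst (x := P.knot i.succ) ⟨hxi.2.2, hxl.le⟩
      have hwi : (P.knot i.succ, w) ∈ column P B i :=
        ⟨h4.left_mem, (P.knot_castSucc_lt_succ i).le, le_rfl⟩
      rcases hw.2.eq_or_lt with hwv | hwv
      · simp only at hwv
        subst hwv
        exact mem_twoWayProxy_of_horizontal_top c hB hg.lt.le hru hrv hwi h4
      · obtain ⟨k, hk1, hk2⟩ := P.exists_edge_of_lt (P.knot_mem i.succ).1
          (hxl.trans_le (hB.fst_mem _ h4.right_mem).2)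
        have hki : k ≤ i := hmax ⟨_, ⟨h4.left_mem, hk1, hk2.le⟩, hy'u.trans_le hw.1, hwv, h4⟩ (by
          by_contra hlt
          exact absurd (P.knot_strictMono.monotone
            (Fin.succ_le_succ_iff.2 (not_le.1 hlt).le)) (not_le.2 hk2))
        exact absurd (P.knot_strictMono.monotone (Fin.succ_le_succ_iff.2 hki))
          (not_le.2 hk2)

end Gap

/-! ### Free spaces have convex compact cells -/

section FreeSpace

variable {d : ℕ} {P S : PolyCurve d} {α δ : ℝ} {A : Set (ℝ × ℝ)}

lemma PolyCurve.toFun_combo (P : PolyCurve d) (i : Fin P.edges) {x y a b : ℝ}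
    (hx : x ∈ Icc (P.knot i.castSucc) (P.knot i.succ))
    (hy : y ∈ Icc (P.knot i.castSucc) (P.knot i.succ)) (ha : 0 ≤ a) (hb : 0 ≤ b)
    (hab : a + b = 1) : P.toFun (a * x + b * y) = a • P.toFun x + b • P.toFun y := by
  have hpos := (sub_pos.2 (P.knot_castSucc_lt_succ i)).ne'
  have hxy : a * x + b * y ∈ Icc (P.knot i.castSucc) (P.knot i.succ) :=
    (convex_Icc _ _) hx hy ha hb hab
  rw [P.toFun_eq_lineMap i hx, P.toFun_eq_lineMap i hy, P.toFun_eq_lineMap i hxy]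
  have e : (a * x + b * y - P.knot i.castSucc) / (P.knot i.succ - P.knot i.castSucc) =
      a * ((x - P.knot i.castSucc) / (P.knot i.succ - P.knot i.castSucc)) +
      b * ((y - P.knot i.castSucc) / (P.knot i.succ - P.knot i.castSucc)) := by
    field_simp
    linear_combination P.knot i.castSucc * hab
  obtain rfl : a = 1 - b := by linarith
  rw [e]
  simp only [AffineMap.lineMap_apply_module]
  module

lemma isClosed_freeSpace : IsClosed (freeSpace P S δ) := by
  have h : ContinuousOn (fun q : ℝ × ℝ => dist (P.toFun q.1) (S.toFun q.2))
      (Icc (0 : ℝ) 1 ×ˢ Icc (0 : ℝ) 1) :=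
    continuous_dist.comp_continuousOn
      ((P.continuousOn.comp continuousOn_fst fun _ hq => hq.1).prodMk
        (S.continuousOn.comp continuousOn_snd fun _ hq => hq.2))
  have e : freeSpace P S δ = (Icc (0 : ℝ) 1 ×ˢ Icc (0 : ℝ) 1) ∩
      (fun q : ℝ × ℝ => dist (P.toFun q.1) (S.toFun q.2)) ⁻¹' Iic δ := by
    ext q
    exact and_assoc.symm
  rw [e]
  exact h.preimage_isClosed_of_isClosed (isClosed_Icc.prod isClosed_Icc) isClosed_Iic

lemma convex_freeSpace_inter_gridCell (i : Fin P.edges) (k : Fin S.edges) :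
    Convex ℝ (freeSpace P S δ ∩ gridCell P S i k) := by
  rintro p ⟨hp, hpc⟩ q ⟨hq, hqc⟩ a b ha hb hab
  refine ⟨⟨(convex_Icc _ _) hp.1 hq.1 ha hb hab, (convex_Icc _ _) hp.2.1 hq.2.1 ha hb hab, ?_⟩,
    (convex_Icc _ _) hpc.1 hqc.1 ha hb hab, (convex_Icc _ _) hpc.2 hqc.2 ha hb hab⟩
  have e1 := P.toFun_combo i hpc.1 hqc.1 ha hb hab
  have e2 := S.toFun_combo k hpc.2 hqc.2 ha hb hab
  have h1 : ‖P.toFun p.1 - S.toFun p.2‖ ≤ δ := by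
    rw [← dist_eq_norm]
    exact hp.2.2
  have h2 : ‖P.toFun q.1 - S.toFun q.2‖ ≤ δ := by
    rw [← dist_eq_norm]
    exact hq.2.2
  show dist (P.toFun (a * p.1 + b * q.1)) (S.toFun (a * p.2 + b * q.2)) ≤ δ
  rw [e1, e2, dist_eq_norm]
  calc ‖a • P.toFun p.1 + b • P.toFun q.1 - (a • S.toFun p.2 + b • S.toFun q.2)‖
      = ‖a • (P.toFun p.1 - S.toFun p.2) + b • (P.toFun q.1 - S.toFun q.2)‖ := by
        congr 1
        module
    _ ≤ a * ‖P.toFun p.1 - S.toFun p.2‖ + b * ‖P.toFun q.1 - S.toFun q.2‖ := by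
        refine (norm_add_le _ _).trans ?_
        rw [norm_smul, norm_smul, Real.norm_of_nonneg ha, Real.norm_of_nonneg hb]
    _ ≤ a * δ + b * δ := by gcongr
    _ = δ := by rw [← add_mul, hab, one_mul]

lemma isCompact_gridCell (i : Fin P.edges) (k : Fin S.edges) : IsCompact (gridCell P S i k) :=
  isCompact_Icc.prod isCompact_Icc

/-- In a closed cell an approximate free space is the closure of its part in the open cell. -/
lemma IsApproxFreeSpace.convex_inter_gridCell (hA : IsApproxFreeSpace P S α δ A)
    (i : Fin P.edges) (k : Fin S.edges) : Convex ℝ (A ∩ gridCell P S i k) := by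
  have hcl := (isCompact_gridCell (P := P) (S := S) i k).isClosed
  have e : A ∩ gridCell P S i k = closure (A ∩ interior (gridCell P S i k)) := by
    refine Subset.antisymm (fun p hp => ?_) ?_
    · by_cases hi : p ∈ interior (gridCell P S i k)
      · exact subset_closure ⟨hp.1, hi⟩
      · exact (hA.boundary p ⟨i, k, subset_closure hp.2, hi⟩).1 hp.1 i k hp.2
    · exact closure_minimal (inter_subset_inter_right _ interior_subset) (hA.closed.inter hcl)
  rw [e]
  exact (hA.convex i k).closure

lemma column_edgePart (k : Fin S.edges) (i : Fin P.edges) :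
    column P (edgePart S A k) i = A ∩ gridCell P S i k := by
  ext q
  constructor
  · rintro ⟨⟨h1, h2⟩, h3⟩
    exact ⟨h1, h3, h2⟩
  · rintro ⟨h1, h3, h2⟩
    exact ⟨⟨h1, h2⟩, h3⟩

lemma freeSpace_subset (hA : IsApproxFreeSpace P S α δ A ∨ A = freeSpace P S δ) :
    freeSpace P S δ ⊆ A :=
  hA.elim (fun h => h.lower) fun h => h.ge

lemma isCellwiseConvex_edgePart (hA : IsApproxFreeSpace P S α δ A ∨ A = freeSpace P S δ)
    (k : Fin S.edges) : IsCellwiseConvex P (edgePart S A k) := by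
  have hcl : IsClosed A := hA.elim (fun h => h.closed) fun h => h ▸ isClosed_freeSpace
  refine ⟨fun i => ?_, fun i => ?_, fun q hq => ?_⟩
  · rw [column_edgePart]
    rcases hA with h | rfl
    · exact h.convex_inter_gridCell i k
    · exact convex_freeSpace_inter_gridCell i k
  · rw [column_edgePart]
    exact (isCompact_gridCell i k).inter_left hcl
  · rcases hA with h | rfl
    · exact (h.upper hq.1).1
    · exact hq.1.1

lemma IsHeightSet.containsExtremalHeights {k : Fin S.edges} {H : Finset ℝ}
    (h : IsHeightSet P S A k H) : ContainsExtremalHeights P (edgePart S A k) H := by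
  intro i q hq
  rw [column_edgePart] at hq
  exact h.2 i q hq

lemma exists_dist_le_of_frechetDist_lt {γ η : ℝ → EuclideanSpace ℝ (Fin d)} {r : ℝ}
    (hγ : ContinuousOn γ (Icc 0 1)) (hη : ContinuousOn η (Icc 0 1)) (h : frechetDist γ η < r)
    {w : ℝ} (hw : w ∈ Icc (0 : ℝ) 1) : ∃ w' ∈ Icc (0 : ℝ) 1, dist (γ w') (η w) ≤ r := by
  obtain ⟨φ, hφ⟩ := exists_orderIso_of_frechetDist_lt hγ hη h
  exact ⟨φ ⟨w, hw⟩, (φ ⟨w, hw⟩).2, hφ ⟨w, hw⟩⟩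

/-- As `S` is close to `P`, no row of the free space is empty, and the end heights of every edge
are heights of extremal points. -/
lemma knot_mem_heightSet (hA : freeSpace P S δ ⊆ A) (hSP : frechetDist S.toFun P.toFun < δ)
    {k : Fin S.edges} {H : Finset ℝ} (hH : ContainsExtremalHeights P (edgePart S A k) H)
    (hB : IsCellwiseConvex P (edgePart S A k)) :
    S.knot k.castSucc ∈ H ∧ S.knot k.succ ∈ H := by
  have hrow : ∀ y ∈ Icc (S.knot k.castSucc) (S.knot k.succ),
      ∃ i x, (x, y) ∈ column P (edgePart S A k) i := by
    intro y hy
    have hy' : y ∈ Icc (0 : ℝ) 1 :=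
      ⟨(S.knot_mem _).1.trans hy.1, hy.2.trans (S.knot_mem _).2⟩
    obtain ⟨x, hx, hxy⟩ := exists_dist_le_of_frechetDist_lt P.continuousOn S.continuousOn
      (frechetDist_comm.trans_lt hSP) hy'
    obtain ⟨i, hi⟩ := P.exists_edge hx
    exact ⟨i, x, ⟨hA ⟨hx, hy', hxy⟩, hy⟩, hi⟩
  have hlt := (S.knot_castSucc_lt_succ k).le
  constructor
  · obtain ⟨i, x, hx⟩ := hrow _ ⟨le_rfl, hlt⟩
    obtain ⟨q, hq⟩ := bottommostPoints_nonempty (hB.compact i) ⟨_, hx⟩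
    rw [show S.knot k.castSucc = q.2 from le_antisymm hq.1.1.2.1 (hq.2.1 _ hx)]
    exact hH i q (Or.inl (Or.inr hq))
  · obtain ⟨i, x, hx⟩ := hrow _ ⟨hlt, le_rfl⟩
    obtain ⟨q, hq⟩ := topmostPoints_nonempty (hB.compact i) ⟨_, hx⟩
    rw [show S.knot k.succ = q.2 from le_antisymm (hq.2.1 _ hx) hq.1.1.2.2]
    exact hH i q (Or.inr hq)

end FreeSpace

/-! ### Sets covered by a bounded number of candidates -/

section Covered

variable {d : ℕ} {P S : PolyCurve d} {A : Set (ℝ × ℝ)} {ℓ : ℕ} {E : Fin S.edges → Finset ℝ}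
  {δ : ℝ} {X Y : Set ℝ} {m n : ℕ}

/-- `X` is covered by the proxy coverages of at most `n` candidates. -/
def IsCoveredBy (P S : PolyCurve d) (A : Set (ℝ × ℝ)) (δ : ℝ) (ℓ : ℕ)
    (E : Fin S.edges → Finset ℝ) (n : ℕ) (X : Set ℝ) : Prop :=
  ∃ C : Finset (Candidate S), (∀ c ∈ C, IsCandidate S ℓ E c) ∧ C.card ≤ n ∧
    X ⊆ ⋃ c ∈ C, proxyCoverage P S A δ c

lemma IsCoveredBy.mono (h : IsCoveredBy P S A δ ℓ E n X) (hYX : Y ⊆ X) (hnm : n ≤ m) :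
    IsCoveredBy P S A δ ℓ E m Y := by
  obtain ⟨C, h1, h2, h3⟩ := h
  exact ⟨C, h1, h2.trans hnm, hYX.trans h3⟩

open Classical in
lemma IsCoveredBy.union (hX : IsCoveredBy P S A δ ℓ E m X) (hY : IsCoveredBy P S A δ ℓ E n Y) :
    IsCoveredBy P S A δ ℓ E (m + n) (X ∪ Y) := by
  obtain ⟨C, h1, h2, h3⟩ := hX
  obtain ⟨D, h1', h2', h3'⟩ := hY
  refine ⟨C ∪ D, fun c hc => (Finset.mem_union.1 hc).elim (h1 c) (h1' c),
    (Finset.card_union_le _ _).trans (add_le_add h2 h2'), union_subset ?_ ?_⟩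
  · exact h3.trans (biUnion_subset_biUnion_left fun c hc => Finset.mem_union_left _ hc)
  · exact h3'.trans (biUnion_subset_biUnion_left fun c hc => Finset.mem_union_right _ hc)

lemma isCoveredBy_empty : IsCoveredBy P S A δ ℓ E 0 ∅ :=
  ⟨∅, by simp, by simp, empty_subset _⟩

lemma IsCandidate.isCoveredBy {c : Candidate S} (hc : IsCandidate S ℓ E c) :
    IsCoveredBy P S A δ ℓ E 1 (proxyCoverage P S A δ c) :=
  ⟨{c}, by simpa using hc, by simp, by simp⟩

/-- The proxy coverages of `S[u, v]` on edge `k` and of its reversal. -/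
abbrev edgeProxy (P S : PolyCurve d) (A : Set (ℝ × ℝ)) (k : Fin S.edges) (u v : ℝ) : Set ℝ :=
  twoWayProxy P (S.knot k.castSucc + S.knot k.succ) (edgePart S A k) u v

lemma isCoveredBy_edgeProxy {k : Fin S.edges} {u v : ℝ}
    (h : ∀ rev, IsCandidate S ℓ E (.subedge k u v rev)) :
    IsCoveredBy P S A δ ℓ E 2 (edgeProxy P S A k u v) :=
  (h false).isCoveredBy.union (h true).isCoveredBy

lemma exists_orderEmbOfFin_eq {H : Finset ℝ} {u : ℝ} (hu : u ∈ H) :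
    ∃ i, H.orderEmbOfFin rfl i = u := by
  have : u ∈ range (H.orderEmbOfFin rfl) := by
    rw [Finset.range_orderEmbOfFin]
    exact hu
  exact this

lemma IsGap.isCoveredBy {k : Fin S.edges} {u v : ℝ} (h : IsGap (E k) u v) :
    IsCoveredBy P S A δ ℓ E 2 (edgeProxy P S A k u v) := by
  obtain ⟨i, rfl⟩ := exists_orderEmbOfFin_eq h.left_mem
  obtain ⟨j, rfl⟩ := exists_orderEmbOfFin_eq h.right_mem
  have hij : (i : ℕ) < j := ((E k).orderEmbOfFin rfl).lt_iff_lt.1 h.lt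
  have hj : (j : ℕ) = i + 2 ^ 0 := by
    by_contra hne
    have hlt : (i : ℕ) + 1 < j := by
      simp at hne
      omega
    rcases h.le_or_le _ (Finset.orderEmbOfFin_mem (E k) rfl ⟨i + 1, hlt.trans j.2⟩) with h1 | h1
    · have := Fin.le_def.1 (((E k).orderEmbOfFin rfl).le_iff_le.1 h1)
      simp at this
    · have := Fin.le_def.1 (((E k).orderEmbOfFin rfl).le_iff_le.1 h1)
      simp at this
      omega
  exact isCoveredBy_edgeProxy fun rev => .typeIII k i j 0 rev (Nat.zero_le _) hj

/-- The points of `P` passed over by monotone paths in `B` from height `y` to height `z`. -/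
def sweep (B : Set (ℝ × ℝ)) (y z : ℝ) : Set ℝ :=
  {x | ∃ a b, HasMonotonePath B (a, y) (b, z) ∧ x ∈ Icc a b}

lemma sweep_subset_union {B : Set (ℝ × ℝ)} {y z w : ℝ} (hw : w ∈ Icc y z) :
    sweep B y z ⊆ sweep B y w ∪ sweep B w z := by
  rintro x ⟨a, b, h, hx⟩
  obtain ⟨c, hc, h1, h2⟩ := h.split_snd hw
  rcases le_total x c with hxc | hxc
  · exact Or.inl ⟨a, c, h1, hx.1, hxc⟩
  · exact Or.inr ⟨c, b, h2, hxc, hx.2⟩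

/-- The two ranges may overlap. -/
lemma sweep_subset_union_of_le {B : Set (ℝ × ℝ)} {y z w w' : ℝ} (hw : w ∈ Icc y z)
    (hw' : w' ∈ Icc y z) (hww : w' ≤ w) : sweep B y z ⊆ sweep B y w ∪ sweep B w' z := by
  rintro x ⟨a, b, h, hx⟩
  obtain ⟨c, hc, h1, h2⟩ := h.split_snd hw
  rcases le_total x c with hxc | hxc
  · exact Or.inl ⟨a, c, h1, hx.1, hxc⟩
  · obtain ⟨c', hc', -, h3⟩ := h1.split_snd (y := w') ⟨hw'.1, hww⟩
    exact Or.inr ⟨c', b, h3.trans h2, hc'.2.trans hxc, hx.2⟩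

/-- Between two heights of the height set: the range is the union of two overlapping ranges that
span a power of two of steps, namely the largest one not exceeding the number of steps. -/
lemma isCoveredBy_sweep_of_mem {k : Fin S.edges} {u v : ℝ}
    (hB : IsCellwiseConvex P (edgePart S A k)) (hu : u ∈ E k) (hv : v ∈ E k) (huv : u < v) :
    IsCoveredBy P S A δ ℓ E 4 (sweep (edgePart S A k) u v) := by
  obtain ⟨i, rfl⟩ := exists_orderEmbOfFin_eq hu
  obtain ⟨j, rfl⟩ := exists_orderEmbOfFin_eq hv
  have hij : (i : ℕ) < j := ((E k).orderEmbOfFin rfl).lt_iff_lt.1 huv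
  set m := Nat.log 2 ((j : ℕ) - i) with hm
  have h1 : 2 ^ m ≤ (j : ℕ) - i := Nat.pow_log_le_self 2 (by omega)
  have h2 : (j : ℕ) - i < 2 ^ (m + 1) := Nat.lt_pow_succ_log_self one_lt_two _
  have h3 : m ≤ Nat.log 2 (E k).card := Nat.log_mono_right (by omega)
  rw [pow_succ] at h2
  have hj := j.2
  let i' : Fin (E k).card := ⟨i + 2 ^ m, by omega⟩
  let j' : Fin (E k).card := ⟨j - 2 ^ m, by omega⟩
  have key := (isCoveredBy_edgeProxy (P := P) (A := A) (δ := δ) (ℓ := ℓ) fun rev =>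
    .typeIII k i i' m rev h3 rfl).union (isCoveredBy_edgeProxy (P := P) (A := A) (δ := δ) fun rev =>
    .typeIII k j' j m rev h3 (by simp only [j']; omega))
  have hmono := ((E k).orderEmbOfFin rfl).monotone
  refine key.mono ((sweep_subset_union_of_le (w := (E k).orderEmbOfFin rfl i')
    (w' := (E k).orderEmbOfFin rfl j') ⟨hmono ?_, hmono ?_⟩ ⟨hmono ?_, hmono ?_⟩
    (hmono ?_)).trans (union_subset_union ?_ ?_)) le_rfl
  · exact Fin.le_def.2 (by simp only [i']; omega)
  · exact Fin.le_def.2 (by simp only [i']; omega)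
  · exact Fin.le_def.2 (by simp only [j']; omega)
  · exact Fin.le_def.2 (by simp only [j']; omega)
  · exact Fin.le_def.2 (by simp only [i', j']; omega)
  all_goals
    rintro x ⟨a, b, h, hx⟩
    exact h.Icc_subset_twoWayProxy hB _ hx

lemma exists_isGap {H : Finset ℝ} {u v y : ℝ} (hu : u ∈ H) (hv : v ∈ H) (huy : u < y)
    (hyv : y < v) (hy : y ∉ H) : ∃ u' v', IsGap H u' v' ∧ u' < y ∧ y < v' := by
  obtain ⟨u', hu', hmax⟩ := (H.filter (· < y)).exists_max_image id
    ⟨u, Finset.mem_filter.2 ⟨hu, huy⟩⟩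
  obtain ⟨v', hv', hmin⟩ := (H.filter (y < ·)).exists_min_image id
    ⟨v, Finset.mem_filter.2 ⟨hv, hyv⟩⟩
  rw [Finset.mem_filter] at hu' hv'
  refine ⟨u', v', ⟨hu'.1, hv'.1, hu'.2.trans hv'.2, fun h hh => ?_⟩, hu'.2, hv'.2⟩
  rcases lt_trichotomy h y with hlt | rfl | hlt
  · exact Or.inl (hmax h (Finset.mem_filter.2 ⟨hh, hlt⟩))
  · exact absurd hh hy
  · exact Or.inr (hmin h (Finset.mem_filter.2 ⟨hh, hlt⟩))

lemma exists_isGap_left {H : Finset ℝ} {u y : ℝ} (hu : u ∈ H) (hy : y ∈ H) (huy : u < y) :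
    ∃ u', IsGap H u' y := by
  obtain ⟨u', hu', hmax⟩ := (H.filter (· < y)).exists_max_image id
    ⟨u, Finset.mem_filter.2 ⟨hu, huy⟩⟩
  rw [Finset.mem_filter] at hu'
  refine ⟨u', hu'.1, hy, hu'.2, fun h hh => ?_⟩
  exact (lt_or_ge h y).imp (fun hlt => hmax h (Finset.mem_filter.2 ⟨hh, hlt⟩)) id

lemma exists_isGap_right {H : Finset ℝ} {v y : ℝ} (hv : v ∈ H) (hy : y ∈ H) (hyv : y < v) :
    ∃ v', IsGap H y v' := by
  obtain ⟨v', hv', hmin⟩ := (H.filter (y < ·)).exists_min_image id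
    ⟨v, Finset.mem_filter.2 ⟨hv, hyv⟩⟩
  rw [Finset.mem_filter] at hv'
  refine ⟨v', hy, hv'.1, hv'.2, fun h hh => ?_⟩
  exact (le_or_gt h y).imp id (fun hlt => hmin h (Finset.mem_filter.2 ⟨hh, hlt⟩))

/-- The hypotheses on the part of an approximate free space over edge `k`, with heights `H`. -/
structure IsEdgeData (P S : PolyCurve d) (A : Set (ℝ × ℝ)) (k : Fin S.edges) (H : Finset ℝ) :
    Prop where
  cells : IsCellwiseConvex P (edgePart S A k)
  heights : ContainsExtremalHeights P (edgePart S A k) H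
  left_mem : S.knot k.castSucc ∈ H
  right_mem : S.knot k.succ ∈ H

variable {k : Fin S.edges} {y z : ℝ}

lemma IsEdgeData.exists_isGap (hk : IsEdgeData P S A k (E k))
    (hy : y ∈ Icc (S.knot k.castSucc) (S.knot k.succ)) (hyE : y ∉ E k) :
    ∃ u v, IsGap (E k) u v ∧ u < y ∧ y < v :=
  _root_.exists_isGap hk.left_mem hk.right_mem
    (hy.1.lt_of_ne fun h => hyE (h ▸ hk.left_mem))
    (hy.2.lt_of_ne fun h => hyE (h ▸ hk.right_mem)) hyE

lemma IsEdgeData.sweep_subset_of_gap (hk : IsEdgeData P S A k (E k)) {u v w : ℝ}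
    (hg : IsGap (E k) u v) (hu : u ≤ y) (hv : z ≤ v) (hw : w ∈ Icc y z) (huw : u < w)
    (hwv : w < v) : sweep (edgePart S A k) y z ⊆ edgeProxy P S A k u v := by
  rintro x ⟨a, b, h, hx⟩
  exact h.Icc_subset_twoWayProxy_of_gap hk.cells hk.heights hg _ hu hv hw huw hwv hx

lemma IsEdgeData.isCoveredBy_sweep_self (hk : IsEdgeData P S A k (E k))
    (hy : y ∈ Icc (S.knot k.castSucc) (S.knot k.succ)) (hyE : y ∉ E k) :
    IsCoveredBy P S A δ ℓ E 2 (sweep (edgePart S A k) y y) := by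
  obtain ⟨u, v, hg, hu, hv⟩ := hk.exists_isGap hy hyE
  exact hg.isCoveredBy.mono (hk.sweep_subset_of_gap hg hu.le hv.le ⟨le_rfl, le_rfl⟩ hu hv) le_rfl

lemma IsEdgeData.isCoveredBy_sweep_right (hk : IsEdgeData P S A k (E k)) (hy : y ∈ E k)
    (hyz : y < z) (hz : z ∈ Icc (S.knot k.castSucc) (S.knot k.succ)) :
    IsCoveredBy P S A δ ℓ E 6 (sweep (edgePart S A k) y z) := by
  by_cases hzE : z ∈ E k
  · exact (isCoveredBy_sweep_of_mem hk.cells hy hzE hyz).mono le_rfl (by norm_num)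
  obtain ⟨u, v, hg, hu, hv⟩ := hk.exists_isGap hz hzE
  have hyu : y ≤ u := (hg.le_or_le y hy).resolve_right (not_le.2 (hyz.trans hv))
  have h1 := hg.isCoveredBy (P := P) (A := A) (δ := δ) (ℓ := ℓ) |>.mono
    (hk.sweep_subset_of_gap hg le_rfl hv.le ⟨hu.le, le_rfl⟩ hu hv) le_rfl
  rcases hyu.eq_or_lt with rfl | hyu
  · exact h1.mono le_rfl (by norm_num)
  · exact ((isCoveredBy_sweep_of_mem hk.cells hy hg.left_mem hyu).union h1).mono
      (sweep_subset_union ⟨hyu.le, hu.le⟩) le_rfl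

lemma IsEdgeData.isCoveredBy_sweep_left (hk : IsEdgeData P S A k (E k)) (hz : z ∈ E k)
    (hyz : y < z) (hy : y ∈ Icc (S.knot k.castSucc) (S.knot k.succ)) :
    IsCoveredBy P S A δ ℓ E 6 (sweep (edgePart S A k) y z) := by
  by_cases hyE : y ∈ E k
  · exact (isCoveredBy_sweep_of_mem hk.cells hyE hz hyz).mono le_rfl (by norm_num)
  obtain ⟨u, v, hg, hu, hv⟩ := hk.exists_isGap hy hyE
  have hvz : v ≤ z := (hg.le_or_le z hz).resolve_left (not_le.2 (hu.trans hyz))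
  have h1 := hg.isCoveredBy (P := P) (A := A) (δ := δ) (ℓ := ℓ) |>.mono
    (hk.sweep_subset_of_gap hg hu.le le_rfl ⟨le_rfl, hv.le⟩ hu hv) le_rfl
  rcases hvz.eq_or_lt with rfl | hvz
  · exact h1.mono le_rfl (by norm_num)
  · exact (h1.union (isCoveredBy_sweep_of_mem hk.cells hg.right_mem hz hvz)).mono
      (sweep_subset_union ⟨hv.le, hvz.le⟩) (by norm_num)

/-- Both ends of the range are rounded inwards to the height set; if no height of the set is in
between, a single gap contains the range. -/
lemma IsEdgeData.isCoveredBy_sweep (hk : IsEdgeData P S A k (E k)) (hyz : y < z)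
    (hy : y ∈ Icc (S.knot k.castSucc) (S.knot k.succ))
    (hz : z ∈ Icc (S.knot k.castSucc) (S.knot k.succ)) :
    IsCoveredBy P S A δ ℓ E 8 (sweep (edgePart S A k) y z) := by
  by_cases hyE : y ∈ E k
  · exact (hk.isCoveredBy_sweep_right hyE hyz hz).mono le_rfl (by norm_num)
  obtain ⟨u, v, hg, hu, hv⟩ := hk.exists_isGap hy hyE
  rcases le_or_gt z v with hzv | hvz
  · exact hg.isCoveredBy.mono
      (hk.sweep_subset_of_gap hg hu.le hzv ⟨le_rfl, hyz.le⟩ hu hv) (by norm_num)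
  · have h1 := hg.isCoveredBy (P := P) (A := A) (δ := δ) (ℓ := ℓ) |>.mono
      (hk.sweep_subset_of_gap hg hu.le le_rfl ⟨le_rfl, hv.le⟩ hu hv) le_rfl
    exact (h1.union (hk.isCoveredBy_sweep_right hg.right_mem hvz hz)).mono
      (sweep_subset_union ⟨hv.le, hvz.le⟩) (by norm_num)

end Covered

/-! ### Counting candidates -/

section Counting

variable {d : ℕ} {P S Q : PolyCurve d} {A : Set (ℝ × ℝ)} {ℓ : ℕ} {E : Fin S.edges → Finset ℝ}
  {δ Δ y z : ℝ} {k : Fin S.edges}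

lemma sweep_freeSpace_subset (hA : freeSpace P S δ ⊆ A)
    (hy : S.knot k.castSucc ≤ y) (hz : z ≤ S.knot k.succ) :
    sweep (freeSpace P S δ) y z ⊆ sweep (edgePart S A k) y z := by
  rintro x ⟨a, b, h, hx⟩
  exact ⟨a, b, h.mono fun q hq => ⟨hA hq.1, hy.trans hq.2.1.2, hq.2.2.2.trans hz⟩, hx⟩

lemma sweep_freeSpace_subset_coverage :
    sweep (freeSpace P S δ) y z ⊆ coverage P (subcurve S.toFun y z) δ := by
  rintro x ⟨a, b, h, hx⟩
  exact ⟨a, b, h.left_mem.1.1, h.le.1, h.right_mem.1.2, frechetDist_le_of_hasMonotonePath h, hx⟩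

/-- Two curves of type (I) cover what is swept between two vertices. -/
lemma isCoveredBy_sweep_knot {i j : Fin (S.edges + 1)} (hij : i < j) (hℓ : (j : ℕ) - i ≤ ℓ) :
    IsCoveredBy P S A δ ℓ E 2 (sweep (freeSpace P S δ) (S.knot i) (S.knot j)) := by
  rw [Fin.lt_def] at hij
  set m := Nat.log 2 ((j : ℕ) - i) with hm
  have h1 : 2 ^ m ≤ (j : ℕ) - i := Nat.pow_log_le_self 2 (by omega)
  have h2 : (j : ℕ) - i < 2 ^ (m + 1) := Nat.lt_pow_succ_log_self one_lt_two _
  have h3 : m ≤ Nat.log 2 ℓ := Nat.log_mono_right hℓ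
  rw [pow_succ] at h2
  have hj := j.2
  let i' : Fin (S.edges + 1) := ⟨i + 2 ^ m, by omega⟩
  let j' : Fin (S.edges + 1) := ⟨j - 2 ^ m, by omega⟩
  have key := ((IsCandidate.typeI (E := E) i i' m h3 rfl).isCoveredBy (P := P) (A := A)
    (δ := δ)).union (IsCandidate.typeI j' j m h3 (by simp only [j']; omega)).isCoveredBy
  have hmono := S.knot_strictMono.monotone
  refine key.mono ((sweep_subset_union_of_le (w := S.knot i') (w' := S.knot j')
    ⟨hmono ?_, hmono ?_⟩ ⟨hmono ?_, hmono ?_⟩ (hmono ?_)).trans (union_subset_union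
      sweep_freeSpace_subset_coverage sweep_freeSpace_subset_coverage)) le_rfl
  · exact Fin.le_def.2 (by simp only [i']; omega)
  · exact Fin.le_def.2 (by simp only [i']; omega)
  · exact Fin.le_def.2 (by simp only [j']; omega)
  · exact Fin.le_def.2 (by simp only [j']; omega)
  · exact Fin.le_def.2 (by simp only [i', j']; omega)

/-- A point of an edge has points of the edge nearby with parameters outside a given finite set. -/
lemma exists_dist_lt_of_finite {p : EuclideanSpace ℝ (Fin d)}
    (hy : y ∈ Icc (S.knot k.castSucc) (S.knot k.succ)) (h : dist p (S.toFun y) < δ)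
    (F : Finset ℝ) : ∃ w ∈ Icc (S.knot k.castSucc) (S.knot k.succ), w ∉ F ∧
      dist p (S.toFun w) < δ := by
  have hcl : y ∈ closure (Ioo (S.knot k.castSucc) (S.knot k.succ) ∩ (F : Set ℝ)ᶜ) := by
    have hd : Dense ((F : Set ℝ)ᶜ) := by
      rw [compl_eq_univ_sdiff]
      exact dense_univ.sdiff_finite F.finite_toSet
    have h1 := closure_minimal (hd.open_subset_closure_inter isOpen_Ioo)
      (isClosed_closure (s := Ioo (S.knot k.castSucc) (S.knot k.succ) ∩ (F : Set ℝ)ᶜ))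
    rw [closure_Ioo (S.knot_castSucc_lt_succ k).ne] at h1
    exact h1 hy
  have hne := mem_closure_iff_nhdsWithin_neBot.1 hcl
  have hc : ContinuousWithinAt (fun w => dist p (S.toFun w))
      (Ioo (S.knot k.castSucc) (S.knot k.succ) ∩ (F : Set ℝ)ᶜ) y :=
    Tendsto.dist tendsto_const_nhds (((S.continuousOn_edge k) y hy).mono
      (inter_subset_left.trans Ioo_subset_Icc_self))
  obtain ⟨w, hw, hw'⟩ := ((hc.eventually_lt continuousWithinAt_const h).and
    self_mem_nhdsWithin).exists
  exact ⟨w, Ioo_subset_Icc_self hw'.1, hw'.2, hw⟩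

lemma IsGap.left_unique {H : Finset ℝ} {u u' v : ℝ} (h : IsGap H u v) (h' : IsGap H u' v) :
    u = u' :=
  le_antisymm ((h'.le_or_le _ h.left_mem).resolve_right (not_le.2 h.lt))
    ((h.le_or_le _ h'.left_mem).resolve_right (not_le.2 h'.lt))

lemma IsGap.right_unique {H : Finset ℝ} {u v v' : ℝ} (h : IsGap H u v) (h' : IsGap H u v') :
    v = v' :=
  le_antisymm ((h.le_or_le _ h'.right_mem).resolve_left (not_le.2 h'.lt))
    ((h'.le_or_le _ h.right_mem).resolve_left (not_le.2 h.lt))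

/-! ### Curves close to a single point of `S` -/

/-- What the candidates spanning the gaps next to the height `y` cover. -/
def gapProxy (P S : PolyCurve d) (A : Set (ℝ × ℝ)) (E : Fin S.edges → Finset ℝ)
    (k : Fin S.edges) (y : ℝ) : Set ℝ :=
  {x | ∃ u, IsGap (E k) u y ∧ x ∈ edgeProxy P S A k u y} ∪
  {x | ∃ v, IsGap (E k) y v ∧ x ∈ edgeProxy P S A k y v}

lemma isCoveredBy_gapProxy : IsCoveredBy P S A δ ℓ E 4 (gapProxy P S A E k y) := by
  refine IsCoveredBy.union (m := 2) (n := 2) ?_ ?_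
  · by_cases h : ∃ u, IsGap (E k) u y
    · obtain ⟨u, hu⟩ := h
      refine hu.isCoveredBy.mono ?_ le_rfl
      rintro x ⟨u', hu', hx⟩
      rwa [hu.left_unique hu']
    · exact isCoveredBy_empty.mono (fun x ⟨u, hu, _⟩ => h ⟨u, hu⟩) (Nat.zero_le _)
  · by_cases h : ∃ v, IsGap (E k) y v
    · obtain ⟨v, hv⟩ := h
      refine hv.isCoveredBy.mono ?_ le_rfl
      rintro x ⟨v', hv', hx⟩
      rwa [hv.right_unique hv']
    · exact isCoveredBy_empty.mono (fun x ⟨v, hv, _⟩ => h ⟨v, hv⟩) (Nat.zero_le _)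

/-- If some point of a horizontal path at height `y` is in the interior of the free space, then
its cell reaches into a gap next to `y`. -/
lemma IsEdgeData.Icc_subset_gapProxy (hk : IsEdgeData P S A k (E k)) (hA : freeSpace P S δ ⊆ A)
    (hyE : y ∈ E k) (hy : y ∈ Icc (S.knot k.castSucc) (S.knot k.succ)) {a b x : ℝ}
    (h : HasMonotonePath (edgePart S A k) (a, y) (b, y)) (hx : x ∈ Icc a b)
    (hxy : dist (P.toFun x) (S.toFun y) < δ) : Icc a b ⊆ gapProxy P S A E k y := by
  have hx01 : x ∈ Icc (0 : ℝ) 1 := ⟨(hk.cells.fst_mem _ h.left_mem).1.trans hx.1,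
    hx.2.trans (hk.cells.fst_mem _ h.right_mem).2⟩
  have h01 : ∀ w ∈ Icc (S.knot k.castSucc) (S.knot k.succ), w ∈ Icc (0 : ℝ) 1 := fun w hw =>
    ⟨(S.knot_mem _).1.trans hw.1, hw.2.trans (S.knot_mem _).2⟩
  obtain ⟨w, hw, hwE, hxw⟩ := exists_dist_lt_of_finite hy hxy (E k)
  obtain ⟨i, hi⟩ := P.exists_edge hx01
  have hyi : (x, y) ∈ column P (edgePart S A k) i := ⟨⟨hA ⟨hx01, h01 y hy, hxy.le⟩, hy⟩, hi⟩
  have hwi : (x, w) ∈ column P (edgePart S A k) i := ⟨⟨hA ⟨hx01, h01 w hw, hxw.le⟩, hw⟩, hi⟩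
  rcases lt_trichotomy w y with hlt | rfl | hlt
  · obtain ⟨u, hg⟩ := exists_isGap_left hk.left_mem hyE (hw.1.trans_lt hlt)
    intro x' hx'
    refine Or.inl ⟨u, hg, ?_⟩
    exact Icc_subset_twoWayProxy_of_horizontal hk.cells _ hg.lt.le
      (row_left_nonempty hk.cells hk.heights hg hwi hyi hlt hg.lt.le) ⟨x, hyi⟩ (Or.inr rfl) h hx
      hyi hx'
  · exact absurd hyE hwE
  · obtain ⟨v, hg⟩ := exists_isGap_right hk.right_mem hyE (hlt.trans_le hw.2)
    intro x' hx'
    refine Or.inr ⟨v, hg, ?_⟩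
    exact Icc_subset_twoWayProxy_of_horizontal hk.cells _ hg.lt.le ⟨x, hyi⟩
      (row_right_nonempty hk.cells hk.heights hg hwi hyi hlt hg.lt.le) (Or.inl rfl) h hx
      hyi hx'

/-- Equality in the triangle inequality: a point at distance at most `Δ` from `q` and at least
`4 * Δ` from `p`, where `dist q p = 3 * Δ`, is determined by `p` and `q`. -/
lemma eq_of_dist_extremal {p q r : EuclideanSpace ℝ (Fin d)} (hqp : dist q p = 3 * Δ)
    (h1 : dist r q ≤ Δ) (h2 : 4 * Δ ≤ dist r p) : r = q + (1 / 3 : ℝ) • (q - p) := by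
  rw [dist_eq_norm] at hqp h1 h2
  have hΔ : 0 ≤ Δ := (norm_nonneg _).trans h1
  have e1 : r - p = (r - q) + (q - p) := by abel
  have h3 := norm_add_sq_real (r - q) (q - p)
  rw [← e1, hqp] at h3
  have h4 := norm_sub_sq_real (r - q) ((1 / 3 : ℝ) • (q - p))
  rw [inner_smul_right, norm_smul, hqp, Real.norm_of_nonneg (by norm_num)] at h4
  have h5 : ‖r - q‖ ^ 2 ≤ Δ ^ 2 := by
    have := norm_nonneg (r - q)
    gcongr
  have h6 : (4 * Δ) ^ 2 ≤ ‖r - p‖ ^ 2 := by gcongr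
  have h7 : ‖r - q - (1 / 3 : ℝ) • (q - p)‖ ^ 2 ≤ 0 := by nlinarith
  have h8 : ‖r - q - (1 / 3 : ℝ) • (q - p)‖ = 0 := by
    have := sq_nonneg ‖r - q - (1 / 3 : ℝ) • (q - p)‖
    exact pow_eq_zero_iff two_ne_zero |>.1 (le_antisymm h7 this)
  have h9 := norm_eq_zero.1 h8
  rw [sub_sub, sub_eq_zero] at h9
  exact h9

/-- The points at the same place as a point close to `S` are covered by two candidates: the height
of the close point of `S` can be moved into a gap. -/
lemma isCoveredBy_fiber (hk : ∀ k, IsEdgeData P S A k (E k)) (hA : freeSpace P S δ ⊆ A)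
    (hSP : frechetDist S.toFun P.toFun < δ) {x₀ : ℝ} (hx₀ : x₀ ∈ Icc (0 : ℝ) 1) :
    IsCoveredBy P S A δ ℓ E 2 {x | x ∈ Icc (0 : ℝ) 1 ∧ P.toFun x = P.toFun x₀} := by
  obtain ⟨r, hr, hrδ⟩ := exists_between hSP
  obtain ⟨y, hy, hxy⟩ := exists_dist_le_of_frechetDist_lt S.continuousOn P.continuousOn hr hx₀
  obtain ⟨k, hyk⟩ := S.exists_edge hy
  rw [dist_comm] at hxy
  obtain ⟨w, hw, hwE, hxw⟩ := exists_dist_lt_of_finite hyk (hxy.trans_lt hrδ) (E k)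
  refine ((hk k).isCoveredBy_sweep_self hw hwE).mono ?_ le_rfl
  rintro x ⟨hx, hxx₀⟩
  refine ⟨x, x, (convex_singleton _).hasMonotonePath rfl rfl le_rfl |>.mono ?_, le_rfl, le_rfl⟩
  rintro q ⟨rfl, -⟩
  exact ⟨hA ⟨hx, ⟨(S.knot_mem _).1.trans hw.1, hw.2.trans (S.knot_mem _).2⟩, hxx₀ ▸ hxw.le⟩, hw⟩

lemma exists_lineMap_eq {s t x : ℝ} (hx : x ∈ Icc s t) :
    ∃ w ∈ Icc (0 : ℝ) 1, AffineMap.lineMap s t w = x := by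
  have h : x ∈ segment ℝ s t := by
    rwa [segment_eq_Icc (hx.1.trans hx.2)]
  rwa [segment_eq_image_lineMap] at h

/-- The coverage of a curve that is close to a single point `S y`, where `y` is in the height set.
A point `x` whose distance to `S y` is less than `4 * Δ` is covered by the candidates next to `y`,
together with every interval that contains it.  If an interval contains no such point, then `Q` runs
on the sphere with radius `3 * Δ` around `S y`, whence it is constant, and all points that are left
are mapped to the same place by `P`. -/
lemma isCoveredBy_coverage_of_mem (hΔ : 0 < Δ) (hk : ∀ k, IsEdgeData P S A k (E k))
    (hA : freeSpace P S (4 * Δ) ⊆ A) (hSP : frechetDist S.toFun P.toFun ≤ 2 * Δ)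
    (hyE : y ∈ E k) (hy : y ∈ Icc (S.knot k.castSucc) (S.knot k.succ))
    (hQ : frechetDist Q.toFun (subcurve S.toFun y y) ≤ 3 * Δ)
    (hcov : coverage P Q.toFun Δ ⊆ sweep (freeSpace P S (4 * Δ)) y y)
    (hpath : ∀ s t, 0 ≤ s → s ≤ t → t ≤ 1 → frechetDist (subcurve P.toFun s t) Q.toFun ≤ Δ →
      HasMonotonePath (freeSpace P S (4 * Δ)) (s, y) (t, y)) :
    IsCoveredBy P S A (4 * Δ) ℓ E 6 (coverage P Q.toFun Δ) := by
  have hy01 : y ∈ Icc (0 : ℝ) 1 := ⟨(S.knot_mem _).1.trans hy.1, hy.2.trans (S.knot_mem _).2⟩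
  have hband : ∀ {a b}, HasMonotonePath (freeSpace P S (4 * Δ)) (a, y) (b, y) →
      HasMonotonePath (edgePart S A k) (a, y) (b, y) := fun h =>
    h.mono fun q hq => ⟨hA hq.1, hy.1.trans hq.2.1.2, hq.2.2.2.trans hy.2⟩
  have hQ3 : ∀ w ∈ Icc (0 : ℝ) 1, dist (Q.toFun w) (S.toFun y) ≤ 3 * Δ := by
    intro w hw
    refine le_of_forall_gt_imp_ge_of_dense fun r hr => ?_
    obtain ⟨w', -, h⟩ := exists_dist_le_of_frechetDist_lt
      (continuousOn_subcurve S.continuousOn hy01.1 le_rfl hy01.2) Q.continuousOn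
      (frechetDist_comm.trans_lt (hQ.trans_lt hr)) hw
    rw [dist_comm]
    simpa [subcurve] using h
  by_cases hQ' : ∃ w ∈ Icc (0 : ℝ) 1, dist (Q.toFun w) (S.toFun y) < 3 * Δ
  · obtain ⟨w, hw, hwlt⟩ := hQ'
    refine (isCoveredBy_gapProxy (k := k) (y := y)).mono ?_ (by norm_num)
    rintro x ⟨s, t, hs, hst, ht, hd, hx⟩
    obtain ⟨r, hr1, hr2⟩ :=
      exists_between (show Δ < 4 * Δ - dist (Q.toFun w) (S.toFun y) by linarith)
    obtain ⟨w', hw', h⟩ := exists_dist_le_of_frechetDist_lt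
      (continuousOn_subcurve P.continuousOn hs hst ht) Q.continuousOn (hd.trans_lt hr1) hw
    refine (hk k).Icc_subset_gapProxy hA hyE hy (hband (hpath s t hs hst ht hd))
      (lineMap_mem_Icc hst hw') ?_ hx
    have := dist_triangle (subcurve P.toFun s t w') (Q.toFun w) (S.toFun y)
    show dist (subcurve P.toFun s t w') (S.toFun y) < _
    linarith
  · have hQeq : ∀ w ∈ Icc (0 : ℝ) 1, dist (Q.toFun w) (S.toFun y) = 3 * Δ := fun w hw =>
      le_antisymm (hQ3 w hw) (not_lt.1 fun h => hQ' ⟨w, hw, h⟩)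
    have hplace : ∀ x ∈ coverage P Q.toFun Δ, 4 * Δ ≤ dist (P.toFun x) (S.toFun y) →
        P.toFun x = Q.toFun 0 + (1 / 3 : ℝ) • (Q.toFun 0 - S.toFun y) := by
      rintro x ⟨s, t, hs, hst, ht, hd, hx⟩ hfar
      refine eq_of_dist_extremal (hQeq 0 ⟨le_rfl, zero_le_one⟩) ?_ hfar
      refine le_of_forall_gt_imp_ge_of_dense fun r hr => ?_
      obtain ⟨w, hw, rfl⟩ := exists_lineMap_eq hx
      obtain ⟨w', hw', h⟩ := exists_dist_le_of_frechetDist_lt Q.continuousOn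
        (continuousOn_subcurve P.continuousOn hs hst ht)
        (frechetDist_comm.trans_lt (hd.trans_lt hr)) hw
      rw [Q.eq_of_dist_eq hQeq hw', dist_comm] at h
      exact h
    have h01 : coverage P Q.toFun Δ ⊆ Icc 0 1 := by
      rintro x ⟨s, t, hs, hst, ht, hd, hx⟩
      exact ⟨hs.trans hx.1, hx.2.trans ht⟩
    have hfar : IsCoveredBy P S A (4 * Δ) ℓ E 2
        {x | x ∈ coverage P Q.toFun Δ ∧ 4 * Δ ≤ dist (P.toFun x) (S.toFun y)} := by
      by_cases hne : ∃ x₀ ∈ coverage P Q.toFun Δ, 4 * Δ ≤ dist (P.toFun x₀) (S.toFun y)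
      · obtain ⟨x₀, hx₀, hx₀'⟩ := hne
        refine (isCoveredBy_fiber hk hA (by linarith) (h01 hx₀)).mono ?_ le_rfl
        rintro x ⟨hx, hx'⟩
        exact ⟨h01 hx, (hplace x hx hx').trans (hplace x₀ hx₀ hx₀').symm⟩
      · exact isCoveredBy_empty.mono (fun x hx => hne ⟨x, hx⟩) (Nat.zero_le _)
    refine ((isCoveredBy_gapProxy (k := k) (y := y)).union hfar).mono (fun x hx => ?_) le_rfl
    rcases lt_or_ge (dist (P.toFun x) (S.toFun y)) (4 * Δ) with hlt | hge
    · obtain ⟨a, b, h, hxab⟩ := hcov hx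
      exact Or.inl ((hk k).Icc_subset_gapProxy hA hyE hy (hband h) hxab hlt hxab)
    · exact Or.inr ⟨hx, hge⟩

/-! ### Subcurves with interior vertices -/

/-- A subcurve of `S` that contains vertices in its interior is cut at the first and at the last
of them. -/
lemma isCoveredBy_sweep_of_vertex (hk : ∀ k, IsEdgeData P S A k (E k))
    (hA : freeSpace P S δ ⊆ A) (hy : 0 ≤ y) (hz : z ≤ 1) (hcompl : S.subComplexity y z ≤ ℓ + 2)
    (hne : ∃ i, y < S.knot i ∧ S.knot i < z) :
    IsCoveredBy P S A δ ℓ E 14 (sweep (freeSpace P S δ) y z) := by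
  set I := {i : Fin (S.edges + 1) | y < S.knot i ∧ S.knot i < z} with hI
  obtain ⟨i, hi, hmin⟩ := (Set.toFinite I).exists_minimal hne
  obtain ⟨j, hj, hmax⟩ := (Set.toFinite I).exists_maximal hne
  have hij : i ≤ j := (le_total i j).elim id fun h => hmin hj h
  have hmono := S.knot_strictMono.monotone
  have hcard : (j : ℕ) - i ≤ ℓ := by
    have h1 : (Icc i j : Set (Fin (S.edges + 1))) ⊆ I := fun m hm =>
      ⟨hi.1.trans_le (hmono hm.1), (hmono hm.2).trans_lt hj.2⟩
    have h2 := Set.ncard_le_ncard h1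
    have h3 : (Icc i j : Set (Fin (S.edges + 1))).ncard = (j : ℕ) + 1 - i := by
      rw [← Finset.coe_Icc, Set.ncard_coe_finset, Fin.card_Icc]
    have h4 : 2 + I.ncard ≤ ℓ + 2 := hcompl
    omega
  have hleft : IsCoveredBy P S A δ ℓ E 6 (sweep (freeSpace P S δ) y (S.knot i)) := by
    have hi0 : i ≠ 0 := by
      rintro rfl
      exact absurd hi.1 (not_lt.2 (S.knot_zero.trans_le hy))
    obtain ⟨k, rfl⟩ := Fin.exists_succ_eq.2 hi0
    have hky : S.knot k.castSucc ≤ y := by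
      by_contra hlt
      have hmem : k.castSucc ∈ I :=
        ⟨not_le.1 hlt, (S.knot_castSucc_lt_succ k).trans hi.2⟩
      exact absurd (hmin hmem k.castSucc_lt_succ.le) (not_le.2 k.castSucc_lt_succ)
    exact ((hk k).isCoveredBy_sweep_left (hk k).right_mem hi.1 ⟨hky, hi.1.le⟩).mono
      (sweep_freeSpace_subset hA hky le_rfl) le_rfl
  have hright : IsCoveredBy P S A δ ℓ E 6 (sweep (freeSpace P S δ) (S.knot j) z) := by
    have hjl : j ≠ Fin.last _ := by
      rintro rfl
      exact absurd hj.2 (not_lt.2 (hz.trans_eq S.knot_last.symm))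
    obtain ⟨k, rfl⟩ := Fin.exists_castSucc_eq.2 hjl
    have hkz : z ≤ S.knot k.succ := by
      by_contra hlt
      have hmem : k.succ ∈ I := ⟨hj.1.trans (S.knot_castSucc_lt_succ k), not_le.1 hlt⟩
      exact absurd (hmax hmem k.castSucc_lt_succ.le) (not_le.2 k.castSucc_lt_succ)
    exact ((hk k).isCoveredBy_sweep_right (hk k).left_mem hj.2 ⟨hj.2.le, hkz⟩).mono
      (sweep_freeSpace_subset hA le_rfl hkz) le_rfl
  have hsplit := sweep_subset_union (B := freeSpace P S δ) (y := y) (z := z) (w := S.knot i)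
    ⟨hi.1.le, hi.2.le⟩
  rcases hij.lt_or_eq with hij | rfl
  · exact (hleft.union ((isCoveredBy_sweep_knot hij hcard).union hright)).mono
      (hsplit.trans (union_subset_union_right _
        (sweep_subset_union ⟨hmono hij.le, hj.2.le⟩))) le_rfl
  · exact (hleft.union hright).mono hsplit (by norm_num)

end Counting

theorem mainTheorem4 (d : ℕ) (P S : PolyCurve d) (Δ : ℝ) (hΔ : 0 < Δ) (ℓ : ℕ) (hℓ : 2 ≤ ℓ)
    (hS : IsSimplification Δ ℓ P S)
    (α : ℝ) (hα : 1 ≤ α) (A : Set (ℝ × ℝ))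
    (hA : IsApproxFreeSpace P S α (4 * Δ) A ∨ A = freeSpace P S (4 * Δ))
    (E : Fin S.edges → Finset ℝ) (hE : ∀ k, IsHeightSet P S A k (E k))
    (Q : PolyCurve d) (hQ : Q.complexity ≤ ℓ) :
    ∃ C : Finset (Candidate S), (∀ c ∈ C, IsCandidate S ℓ E c) ∧ C.card ≤ 16 ∧
      coverage P Q.toFun Δ ⊆ ⋃ c ∈ C, proxyCoverage P S A (4 * Δ) c := by
  show IsCoveredBy P S A (4 * Δ) ℓ E 16 (coverage P Q.toFun Δ)
  have hsub := freeSpace_subset hA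
  have hk : ∀ k, IsEdgeData P S A k (E k) := fun k =>
    have hB := isCellwiseConvex_edgePart hA k
    have hH := (hE k).containsExtremalHeights
    have hkn := knot_mem_heightSet hsub (hS.1.trans_lt (by linarith)) hH hB
    ⟨hB, hH, hkn.1, hkn.2⟩
  by_cases hne : (coverage P Q.toFun Δ).Nonempty
  swap
  · exact isCoveredBy_empty.mono (not_nonempty_iff_eq_empty.1 hne).subset (Nat.zero_le _)
  -- the subcurve of `S` assigned to one of the subcurves of `P` close to `Q` serves for all of them
  obtain ⟨x₀, s₀, t₀, hs₀, hst₀, ht₀, hd₀, -⟩ := hne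
  rw [frechetDist_comm] at hd₀
  obtain ⟨y, z, hy, hyz, hz, hyz2, hcompl⟩ := hS.2 Q hQ s₀ t₀ hs₀ hst₀ ht₀ hd₀
  have hPc := continuousOn_subcurve P.continuousOn hs₀ hst₀ ht₀
  have hSc := continuousOn_subcurve S.continuousOn hy hyz hz
  have hQS : frechetDist Q.toFun (subcurve S.toFun y z) ≤ 3 * Δ := by
    have := frechetDist_triangle Q.continuousOn hPc hSc
    linarith
  have hpath : ∀ s t, 0 ≤ s → s ≤ t → t ≤ 1 → frechetDist (subcurve P.toFun s t) Q.toFun ≤ Δ →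
      HasMonotonePath (freeSpace P S (4 * Δ)) (s, y) (t, z) := by
    intro s t hs hst ht hd
    refine hasMonotonePath_of_frechetDist_le hs hst ht hy hyz hz ?_
    have := frechetDist_triangle (continuousOn_subcurve P.continuousOn hs hst ht) Q.continuousOn hSc
    linarith
  have hcov : coverage P Q.toFun Δ ⊆ sweep (freeSpace P S (4 * Δ)) y z := by
    rintro x ⟨s, t, hs, hst, ht, hd, hx⟩
    exact ⟨s, t, hpath s t hs hst ht hd, hx⟩
  by_cases hv : ∃ i, y < S.knot i ∧ S.knot i < z
  · exact (isCoveredBy_sweep_of_vertex hk hsub hy hz hcompl hv).mono hcov (by norm_num)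
  obtain ⟨k, hky, hkz⟩ : ∃ k : Fin S.edges, S.knot k.castSucc ≤ y ∧ z ≤ S.knot k.succ := by
    rcases (hyz.trans hz).lt_or_eq with hlt | rfl
    · obtain ⟨k, h1, h2⟩ := S.exists_edge_of_lt hy hlt
      exact ⟨k, h1, not_lt.1 fun h => hv ⟨_, h2, h⟩⟩
    · obtain ⟨k, h1, h2⟩ := S.exists_edge ⟨zero_le_one, le_rfl⟩
      exact ⟨k, h1, hz.trans h2⟩
  rcases hyz.lt_or_eq with hlt | rfl
  · exact ((hk k).isCoveredBy_sweep hlt ⟨hky, hyz.trans hkz⟩ ⟨hky.trans hyz, hkz⟩).mono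
      (hcov.trans (sweep_freeSpace_subset hsub hky hkz)) (by norm_num)
  · by_cases hyE : y ∈ E k
    · exact (isCoveredBy_coverage_of_mem hΔ hk hsub hS.1 hyE ⟨hky, hkz⟩ hQS hcov hpath).mono
        le_rfl (by norm_num)
    · exact ((hk k).isCoveredBy_sweep_self ⟨hky, hkz⟩ hyE).mono
        (hcov.trans (sweep_freeSpace_subset hsub hky hkz)) (by norm_num)
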